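/- Let $k$ be a field. Let $\mathcal C$ be the category whose objects are the finite sets and in which a morphism from $X$ to $Y$ is a subset of $Y\times X$ (a correspondence), with composition $RS=\{(z,x)\mid \exists y,\ (z,y)\in R,\ (y,x)\in S\}$. Let $k\mathcal C$ be its $k$-linearization, in which the module $k\mathcal C(Y,X)$ of morphisms from $X$ to $Y$ is free on the correspondences $Q\subseteq Y\times X$. A correspondence functor over $k$ is a $k$-linear functor from $k\mathcal C$ to $k$-modules. The dual $F^\natural$ of a correspondence functor $F$ is given by $F^\natural(X)=\mathrm{Hom}_k(F(X),k)$ and, for $Q\subseteq Y\times X$ and $\alpha\in F^\natural(X)$, by $F^\natural(Q)(\alpha)=\alpha\circ F(Q^{op})$, where $Q^{op}=\{(x,y)\mid (y,x)\in Q\}$. Let $E$ be a finite set. The algebra of permuted orders $\mathcal P_E$ is the quotient of the algebra $k\mathcal C(E,E)$ of all relations on $E$ by the two-sided ideal generated by the relations that factor through a set of cardinality smaller than $|E|$ and by the differences $S-\overline S$, where $S$ is a reflexive relation and $\overline S$ its transitive closure. For a (partial) order $R$ on $E$ let $f_R=\sum_{S\supseteq R}\mu(R,S)\,S\in\mathcal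 P_E$, where $S$ runs over the orders on $E$ containing $R$ and $\mu$ is the Möbius function of the set of all orders on $E$, ordered by inclusion. The left ideal $\mathcal P_Ef_R$ is a right module for $\mathrm{Aut}(E,R)$, an automorphism $\tau$ acting by right multiplication by $\Delta_\tau=\{(\tau(x),x)\mid x\in E\}$. For a $k\mathrm{Aut}(E,R)$-module $V$ put $T_{R,V}=\mathcal P_Ef_R\otimes_{k\mathrm{Aut}(E,R)}V$, a left module for $\mathcal P_E$ and hence for $k\mathcal C(E,E)$. For a left $k\mathcal C(E,E)$-module $W$, let $L_{E,W}$ be the correspondence functor $L_{E,W}(X)=k\mathcal C(X,E)\otimes_{k\mathcal C(E,E)}W$, and let $J_{E,W}$ be its subfunctor such that $J_{E,W}(X)$ consists of the elements $\sum_i\varphi_i\otimes w_i$ of $L_{E,W}(X)$ with $\sum_i(\psi\varphi_i)\cdot w_i=0$ for all $\psi\in k\mathcal C(E,X)$. Put $S_{E,R,V}=L_{E,T_{R,V}}/J_{E,T_{R,V}}$. Theorem. Let $k$ be a field, $E$ a finite set, $R$ an order on $E$ and $V$ a simple $k\mathrm{Aut}(E,R)$-module. Let $R^{op}$ be the opposite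 order and let $V^\natural=\mathrm{Hom}_k(V,k)$ with the action $(\tau\cdot\alpha)(v)=\alpha(\tau^{-1}v)$, regarded as a module for $k\mathrm{Aut}(E,R^{op})=k\mathrm{Aut}(E,R)$. Then the correspondence functors $S_{E,R,V}^\natural$ and $S_{E,R^{op},V^\natural}$ are isomorphic. -/

import Mathlib

open CategoryTheory
open scoped TensorProduct

universe u

noncomputable section

namespace CorrespondenceFunctors

/-! ### The category of finite sets and correspondences -/

/-- The objects of the category of finite sets and correspondences. -/
structure FinCorr : Type (u + 1) where
  /-- the underlying set -/
  carrier : Type u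
  [finite : Finite carrier]

attribute [instance] FinCorr.finite

instance : CoeSort FinCorr.{u} (Type u) := ⟨FinCorr.carrier⟩

/-- A morphism from `X` to `Y` is a subset of `Y × X`. The composite of `S ⊆ Y × X` and `R ⊆ Z × Y`
is `RS = {(z, x) | ∃ y, (z, y) ∈ R ∧ (y, x) ∈ S}`, written `S ≫ R` in diagrammatic order. -/
instance : Category.{u} FinCorr.{u} where
  Hom X Y := Set (Y × X)
  id X := {p | p.1 = p.2}
  comp {X _ Z} S R := {p : Z × X | ∃ y, (p.1, y) ∈ R ∧ (y, p.2) ∈ S}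
  id_comp f := by
    apply Set.ext; rintro ⟨y, x⟩; simp
  comp_id f := by
    apply Set.ext; rintro ⟨y, x⟩; simp
  assoc f g h := by
    apply Set.ext; rintro ⟨z, x⟩
    constructor
    · rintro ⟨y, hy, w, hw, hx⟩; exact ⟨w, ⟨y, hy, hw⟩, hx⟩
    · rintro ⟨w, ⟨y, hy, hw⟩, hx⟩; exact ⟨y, hy, w, hw, hx⟩

/-- The correspondence from `X` to `Y` given by a subset of `Y × X`. -/
def corr {X Y : FinCorr.{u}} (Q : Set (Y × X)) : X ⟶ Y := Q

/-- The subset of `Y × X` underlying a correspondence from `X` to `Y`. -/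
def graph {X Y : FinCorr.{u}} (Q : X ⟶ Y) : Set (Y × X) := Q

/-- The opposite `{(x, y) | (y, x) ∈ Q} ⊆ X × Y` of a correspondence `Q ⊆ Y × X`. -/
def opp {X Y : FinCorr.{u}} (Q : X ⟶ Y) : Y ⟶ X := corr {p | (p.2, p.1) ∈ graph Q}

lemma opp_id (X : FinCorr.{u}) : opp (𝟙 X) = 𝟙 X := by
  apply Set.ext; rintro ⟨y, x⟩; exact eq_comm

lemma opp_comp {X Y Z : FinCorr.{u}} (f : X ⟶ Y) (g : Y ⟶ Z) :
    opp (f ≫ g) = opp g ≫ opp f := by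
  apply Set.ext; rintro ⟨z, x⟩
  constructor
  · rintro ⟨y, hy, hx⟩; exact ⟨y, hx, hy⟩
  · rintro ⟨y, hy, hx⟩; exact ⟨y, hx, hy⟩

/-! ### Correspondence functors and their duals -/

/-- The `k`-linearization of the category of finite sets and correspondences. -/
abbrev LinCorr (k : Type u) [CommRing k] : Type (u + 1) := Free k FinCorr.{u}

/-- A finite set, as an object of the linearized category. -/
abbrev LinCorr.of (k : Type u) [CommRing k] (E : Type u) [Finite E] : LinCorr k :=
  Free.of k (FinCorr.mk E)

/-- Being a `k`-linear functor from the linearized category to the category of `k`-modules. -/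
def isLinearFunctor (k : Type u) [CommRing k] :
    ObjectProperty (LinCorr k ⥤ ModuleCat.{u} k) :=
  fun F => F.Additive ∧ F.Linear k

/-- The category of correspondence functors over `k`: the `k`-linear functors from the
linearized category of finite sets and correspondences to `k`-modules, with the natural
transformations as morphisms. -/
abbrev CorrespondenceFunctor (k : Type u) [CommRing k] :=
  (isLinearFunctor k).FullSubcategory

section Dual

variable (k : Type u) [CommRing k]

variable {k} {X Y Z : LinCorr k}

lemma hom_induction {P : (X ⟶ Y) → Prop} (f : X ⟶ Y) (zero : P 0)
    (add : ∀ f g : X ⟶ Y, P f → P g → P (f + g))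
    (single : ∀ (Q : @Quiver.Hom FinCorr.{u} _ X Y) (c : k), P (Finsupp.single Q c)) : P f :=
  Finsupp.induction_linear f zero add single

/-- The opposite of a `k`-linear combination of correspondences: the `k`-linear map sending
each basis element `Q` to `Q^op`. -/
def linOpp : (X ⟶ Y) →ₗ[k] (Y ⟶ X) :=
  Finsupp.lmapDomain k k (fun Q : @Quiver.Hom FinCorr.{u} _ X Y => opp Q)

lemma linOpp_single (X Y : FinCorr.{u}) (Q : X ⟶ Y) (c : k) :
    linOpp (k := k) (X := Free.of k X) (Y := Free.of k Y) (Finsupp.single Q c) =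
      Finsupp.single (opp Q) c :=
  Finsupp.mapDomain_single

lemma linOpp_id (X : LinCorr k) : linOpp (𝟙 X) = 𝟙 X :=
  (linOpp_single X X (𝟙 _) 1).trans (congrArg (fun Q => Finsupp.single Q (1 : k)) (opp_id X))

lemma linOpp_comp_single {X Y Z : FinCorr.{u}} (Q : X ⟶ Y) (Q' : Y ⟶ Z) (c c' : k) :
    linOpp (X := Free.of k X) (Y := Free.of k Z)
        ((Finsupp.single Q c : Free.of k X ⟶ Free.of k Y) ≫
          (Finsupp.single Q' c' : Free.of k Y ⟶ Free.of k Z)) =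
      linOpp (Finsupp.single Q' c' : Free.of k Y ⟶ Free.of k Z) ≫
        linOpp (Finsupp.single Q c : Free.of k X ⟶ Free.of k Y) := by
  rw [linOpp_single, linOpp_single]
  refine (congrArg linOpp (Free.single_comp_single k FinCorr.{u} Q Q' c c')).trans ?_
  refine (linOpp_single _ _ _ _).trans ?_
  refine Eq.trans ?_ (Free.single_comp_single k FinCorr.{u} _ _ _ _).symm
  rw [mul_comm, opp_comp]
  rfl

lemma linOpp_comp (f : X ⟶ Y) (g : Y ⟶ Z) : linOpp (f ≫ g) = linOpp g ≫ linOpp f := by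
  refine hom_induction (P := fun f => linOpp (f ≫ g) = linOpp g ≫ linOpp f) f
    (by rw [Limits.zero_comp, map_zero, map_zero, Limits.comp_zero]) (fun f₁ f₂ h₁ h₂ => ?_) (fun Q c => ?_)
  · rw [Preadditive.add_comp, map_add, map_add, Preadditive.comp_add, h₁, h₂]
  · refine hom_induction
      (P := fun g => linOpp ((show X ⟶ Y from Finsupp.single Q c) ≫ g) = linOpp g ≫ linOpp _) g
      (by rw [Limits.comp_zero, map_zero, map_zero, Limits.zero_comp]) (fun g₁ g₂ h₁ h₂ => ?_) (fun Q' c' => ?_)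
    · rw [Preadditive.comp_add, map_add, map_add, Preadditive.add_comp, h₁, h₂]
    · exact linOpp_comp_single Q Q' c c'

/-- The underlying functor of the dual of a correspondence functor. -/
def dualAux (F : LinCorr k ⥤ ModuleCat.{u} k) : LinCorr k ⥤ ModuleCat.{u} k where
  obj X := ModuleCat.of k (Module.Dual k (F.obj X))
  map f := ModuleCat.ofHom (F.map (linOpp f)).hom.dualMap
  map_id X := by
    rw [linOpp_id, F.map_id]; rfl
  map_comp f g := by
    rw [linOpp_comp, F.map_comp]; rfl

/-- The dual of a correspondence functor `F`, defined by `X ↦ Hom_k(F(X), k)`;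
a correspondence `Q` acts by `α ↦ α ∘ F(Q^op)`. -/
def dualFunctor (F : CorrespondenceFunctor k) : CorrespondenceFunctor k where
  obj := dualAux F.obj
  property := by
    have := F.property.1
    have := F.property.2
    refine ⟨⟨?_⟩, ⟨?_⟩⟩
    · intro X Y f g
      apply ModuleCat.hom_ext
      change (F.obj.map (linOpp (f + g))).hom.dualMap =
        (F.obj.map (linOpp f)).hom.dualMap + (F.obj.map (linOpp g)).hom.dualMap
      rw [map_add, F.obj.map_add, ModuleCat.hom_add]
      apply LinearMap.ext; intro α
      exact LinearMap.comp_add _ _ α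
    · intro X Y f r
      apply ModuleCat.hom_ext
      change (F.obj.map (linOpp (r • f))).hom.dualMap = r • (F.obj.map (linOpp f)).hom.dualMap
      rw [map_smul, F.obj.map_smul, ModuleCat.hom_smul]
      apply LinearMap.ext; intro α
      exact LinearMap.comp_smul α r _

end Dual

/-! ### The functors `L_{E,W}`, `J_{E,W}` and `L_{E,W} / J_{E,W}` -/

/-- The algebra `k𝒞(E,E)` of all relations on `E`. The product `a * b` is `a ∘ b`. -/
abbrev RelAlg (k : Type u) [CommRing k] (E : Type u) [Finite E] : Type u :=
  End (LinCorr.of k E)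

section Simple

variable (k : Type u) [CommRing k] (E : Type u) [Finite E]
variable (W : Type u) [AddCommGroup W] [Module k W] [Module (RelAlg k E) W]

/-- The relations `(φ ∘ a) ⊗ w = φ ⊗ (a • w)` defining the tensor product over `k𝒞(E,E)`. -/
def tensorRel (X : LinCorr k) : Submodule k ((LinCorr.of k E ⟶ X) ⊗[k] W) :=
  Submodule.span k {t | ∃ (φ : LinCorr.of k E ⟶ X) (a : RelAlg k E) (w : W),
    t = ((show LinCorr.of k E ⟶ LinCorr.of k E from a) ≫ φ) ⊗ₜ[k] w - φ ⊗ₜ[k] (a • w)}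

/-- The module `L_{E,W}(X) = k𝒞(X,E) ⊗_{k𝒞(E,E)} W`. -/
abbrev LObj (X : LinCorr k) : Type u :=
  ((LinCorr.of k E ⟶ X) ⊗[k] W) ⧸ tensorRel k E W X

variable {X Y Z : LinCorr k}

/-- Composition with `f : X ⟶ Y`, as a map `L_{E,W}(X) → L_{E,W}(Y)`. -/
def LMap (f : X ⟶ Y) : LObj k E W X →ₗ[k] LObj k E W Y :=
  Submodule.mapQ _ _ (LinearMap.rTensor W (Linear.rightComp k (LinCorr.of k E) f)) (by
    rw [tensorRel, Submodule.span_le]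
    rintro _ ⟨φ, a, w, rfl⟩
    apply Submodule.subset_span
    refine ⟨φ ≫ f, a, w, ?_⟩
    simp)

variable [IsScalarTower k (RelAlg k E) W]

/-- For `ψ ∈ k𝒞(E,X)`, the map `L_{E,W}(X) → W` with `φ ⊗ w ↦ (ψφ) • w`. -/
def LEval (ψ : X ⟶ LinCorr.of k E) : LObj k E W X →ₗ[k] W :=
  Submodule.liftQ _
    (TensorProduct.lift (LinearMap.mk₂ k
      (fun (φ : LinCorr.of k E ⟶ X) (w : W) => (show RelAlg k E from φ ≫ ψ) • w)
      (fun φ φ' w => by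
        rw [Preadditive.add_comp]; exact add_smul _ _ _)
      (fun c φ w => by
        change (show RelAlg k E from (c • φ) ≫ ψ) • w = _
        rw [Linear.smul_comp]; exact smul_assoc c (show RelAlg k E from φ ≫ ψ) w)
      (fun φ w w' => smul_add _ _ _)
      (fun c φ w => by
        rw [← algebraMap_smul (RelAlg k E) c w, ← mul_smul, ← Algebra.commutes, mul_smul,
          algebraMap_smul])))
    (by
      rw [tensorRel, Submodule.span_le]
      rintro _ ⟨φ, a, w, rfl⟩
      change _ = _
      rw [map_sub, sub_eq_zero, TensorProduct.lift.tmul, TensorProduct.lift.tmul]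
      change (show RelAlg k E from (_ ≫ φ) ≫ ψ) • w = (show RelAlg k E from φ ≫ ψ) • a • w
      rw [Category.assoc, ← mul_smul]; rfl)

/-- `J_{E,W}(X)` consists of the elements `∑ φ_i ⊗ w_i` of `L_{E,W}(X)` such that
`∑ (ψφ_i) • w_i = 0` for all `ψ ∈ k𝒞(E,X)`. -/
def JObj (X : LinCorr k) : Submodule k (LObj k E W X) :=
  ⨅ ψ : X ⟶ LinCorr.of k E, LinearMap.ker (LEval k E W ψ)

lemma LEval_LMap (f : X ⟶ Y) (ψ : Y ⟶ LinCorr.of k E) (x : LObj k E W X) :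
    LEval k E W ψ (LMap k E W f x) = LEval k E W (f ≫ ψ) x := by
  obtain ⟨x, rfl⟩ := Submodule.Quotient.mk_surjective _ x
  induction x using TensorProduct.induction_on with
  | zero => simp
  | tmul φ w =>
    change (show RelAlg k E from (φ ≫ f) ≫ ψ) • w = (show RelAlg k E from φ ≫ f ≫ ψ) • w
    rw [Category.assoc]
  | add x y hx hy => simp only [Submodule.Quotient.mk_add, map_add, hx, hy]

lemma JObj_le_comap (f : X ⟶ Y) : JObj k E W X ≤ (JObj k E W Y).comap (LMap k E W f) := by
  intro x hx
  rw [Submodule.mem_comap, JObj, Submodule.mem_iInf]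
  intro ψ
  rw [LinearMap.mem_ker, LEval_LMap]
  exact (Submodule.mem_iInf _).1 hx (f ≫ ψ)

/-- The map `L_{E,W}(X) / J_{E,W}(X) → L_{E,W}(Y) / J_{E,W}(Y)` induced by `f : X ⟶ Y`. -/
def SMap (f : X ⟶ Y) : (LObj k E W X ⧸ JObj k E W X) →ₗ[k] (LObj k E W Y ⧸ JObj k E W Y) :=
  Submodule.mapQ _ _ (LMap k E W f) (JObj_le_comap k E W f)

lemma quot_ext {M : Type u} [AddCommGroup M] [Module k M]
    {g h : (LObj k E W X ⧸ JObj k E W X) →ₗ[k] M}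
    (H : ∀ (φ : LinCorr.of k E ⟶ X) (w : W),
      g (Submodule.Quotient.mk (Submodule.Quotient.mk (φ ⊗ₜ[k] w))) =
        h (Submodule.Quotient.mk (Submodule.Quotient.mk (φ ⊗ₜ[k] w)))) : g = h := by
  apply Submodule.linearMap_qext
  apply Submodule.linearMap_qext
  apply TensorProduct.ext'
  exact H

lemma SMap_mk (f : X ⟶ Y) (φ : LinCorr.of k E ⟶ X) (w : W) :
    SMap k E W f (Submodule.Quotient.mk (Submodule.Quotient.mk (φ ⊗ₜ[k] w))) =
      Submodule.Quotient.mk (Submodule.Quotient.mk ((φ ≫ f) ⊗ₜ[k] w)) := rfl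

/-- The correspondence functor `L_{E,W} / J_{E,W}`. -/
def quotientFunctor : CorrespondenceFunctor k where
  obj :=
    { obj X := ModuleCat.of k (LObj k E W X ⧸ JObj k E W X)
      map f := ModuleCat.ofHom (SMap k E W f)
      map_id X := by
        apply ModuleCat.hom_ext
        apply quot_ext
        intro φ w
        change SMap k E W (𝟙 X) _ = _
        rw [SMap_mk, Category.comp_id]; rfl
      map_comp f g := by
        apply ModuleCat.hom_ext
        apply quot_ext
        intro φ w
        refine (SMap_mk k E W (f ≫ g) φ w).trans ?_
        rw [← Category.assoc]
        exact (SMap_mk k E W g (φ ≫ f) w).symm }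
  property := by
    refine ⟨⟨?_⟩, ⟨?_⟩⟩
    · intro X Y f g
      apply ModuleCat.hom_ext
      apply quot_ext
      intro φ w
      change SMap k E W (f + g) _ = SMap k E W f _ + SMap k E W g _
      rw [SMap_mk, SMap_mk, SMap_mk, Preadditive.comp_add, TensorProduct.add_tmul]; rfl
    · intro X Y f r
      apply ModuleCat.hom_ext
      apply quot_ext
      intro φ w
      change SMap k E W (r • f) _ = r • SMap k E W f _
      rw [SMap_mk, SMap_mk, Linear.comp_smul, ← TensorProduct.smul_tmul']; rfl

end Simple

/-! ### Orders and the algebra of permuted orders -/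

/-- The order relations on `E`, as subsets of `E × E`. -/
structure OrderRel (E : Type u) where
  /-- the set of pairs in relation -/
  rel : Set (E × E)
  refl : ∀ x, (x, x) ∈ rel
  antisymm : ∀ x y, (x, y) ∈ rel → (y, x) ∈ rel → x = y
  trans : ∀ x y z, (x, y) ∈ rel → (y, z) ∈ rel → (x, z) ∈ rel

namespace OrderRel

variable {E : Type u}

lemma rel_injective : Function.Injective (OrderRel.rel : OrderRel E → Set (E × E)) := by
  rintro ⟨⟩ ⟨⟩ h; cases h; rfl

/-- Orders on `E` are ordered by inclusion. -/
instance : PartialOrder (OrderRel E) := PartialOrder.lift OrderRel.rel rel_injective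

instance [Finite E] : Finite (OrderRel E) := Finite.of_injective _ rel_injective

instance [Finite E] : Fintype (OrderRel E) := Fintype.ofFinite _

open Classical in
instance [Finite E] : LocallyFiniteOrder (OrderRel E) := Fintype.toLocallyFiniteOrder

/-- The opposite order. -/
def op (R : OrderRel E) : OrderRel E where
  rel := {p | (p.2, p.1) ∈ R.rel}
  refl x := R.refl x
  antisymm x y h h' := R.antisymm x y h' h
  trans x y z h h' := R.trans z y x h' h

/-- The group `Aut(E,R)` of automorphisms of the poset `(E,R)`. -/
def aut (R : OrderRel E) : Subgroup (Equiv.Perm E) where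
  carrier := {σ | ∀ x y, (σ x, σ y) ∈ R.rel ↔ (x, y) ∈ R.rel}
  one_mem' _ _ := Iff.rfl
  mul_mem' {σ τ} hσ hτ x y := (hσ (τ x) (τ y)).trans (hτ x y)
  inv_mem' {σ} hσ x y := by
    have := hσ (σ⁻¹ x) (σ⁻¹ y)
    simpa using this.symm

/-- An automorphism of `(E,R^op)` is an automorphism of `(E,R)`. -/
def autOp (R : OrderRel E) : R.op.aut →* R.aut :=
  Subgroup.inclusion (fun _ hσ x y => hσ y x)

/-- The conjugate order `{(σ x, σ y) | (x, y) ∈ R}`. -/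
def conj (σ : Equiv.Perm E) (R : OrderRel E) : OrderRel E where
  rel := {p | (σ⁻¹ p.1, σ⁻¹ p.2) ∈ R.rel}
  refl _ := R.refl _
  antisymm _ _ h h' := σ⁻¹.injective (R.antisymm _ _ h h')
  trans _ _ _ h h' := R.trans _ _ _ h h'

/-- Conjugation by `σ` is an automorphism of the poset of orders on `E`. -/
def conjIso (σ : Equiv.Perm E) : OrderRel E ≃o OrderRel E where
  toFun := conj σ
  invFun := conj σ⁻¹
  left_inv R := by apply rel_injective; ext ⟨x, y⟩; simp [conj]
  right_inv R := by apply rel_injective; ext ⟨x, y⟩; simp [conj]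
  map_rel_iff' {R S} := by
    constructor
    · rintro h ⟨x, y⟩ hp
      have := @h (σ x, σ y) (by simpa [conj] using hp)
      simpa [conj] using this
    · rintro h ⟨x, y⟩ hp
      exact h hp

lemma conj_eq_self (R : OrderRel E) {σ : Equiv.Perm E} (hσ : σ ∈ R.aut) : R.conj σ = R := by
  apply rel_injective; ext ⟨x, y⟩
  exact (R.aut.inv_mem hσ) x y

end OrderRel

section PermutedOrders

variable (k : Type u) [CommRing k] {E : Type u} [Finite E]

/-- A relation `Q` on `E` as a basis element of `k𝒞(E,E)`. -/
def relBasis (Q : Set (E × E)) : RelAlg k E :=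
  show LinCorr.of k E ⟶ LinCorr.of k E from
    (Free.embedding k FinCorr.{u}).map (corr (X := FinCorr.mk E) (Y := FinCorr.mk E) Q)

/-- The relation `Δ_σ = {(σ x, x)}`. -/
def permRel (σ : Equiv.Perm E) : Set (E × E) := {p | p.1 = σ p.2}

/-- The transitive closure of a relation. -/
def transClosure (S : Set (E × E)) : Set (E × E) :=
  {p | Relation.TransGen (fun x y => (x, y) ∈ S) p.1 p.2}

/-- A relation on `E` is inessential if it factors through a set of cardinality
smaller than that of `E`. -/
def Inessential (Q : Set (E × E)) : Prop :=
  ∃ (Y : FinCorr.{u}) (f : FinCorr.mk E ⟶ Y) (g : Y ⟶ FinCorr.mk E),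
    Nat.card Y < Nat.card E ∧ graph (f ≫ g) = Q

/-- The defining relations of the algebra of permuted orders: inessential relations are zero,
and a reflexive relation is equal to its transitive closure. -/
inductive PermutedOrderRel : RelAlg k E → RelAlg k E → Prop
  | inessential (Q : Set (E × E)) (hQ : Inessential Q) : PermutedOrderRel (relBasis k Q) 0
  | closure (S : Set (E × E)) (hS : ∀ x, (x, x) ∈ S) :
      PermutedOrderRel (relBasis k S) (relBasis k (transClosure S))

variable (E) in
/-- The algebra of permuted orders `𝒫_E`, the quotient of the algebra `k𝒞(E,E)` of all relations
by the two-sided ideal generated by the inessential relations and the differences between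
reflexive relations and their transitive closures. It has a basis consisting of the classes of
the relations `Δ_σ R` with `σ` a permutation and `R` an order; the product of two orders is the
transitive closure of their union if this is an order, and zero otherwise. -/
def PermOrderAlg : Type u := RingQuot (PermutedOrderRel k (E := E))

instance : Ring (PermOrderAlg k E) := inferInstanceAs (Ring (RingQuot (PermutedOrderRel k)))

instance : Algebra k (PermOrderAlg k E) :=
  inferInstanceAs (Algebra k (RingQuot (PermutedOrderRel k)))

variable (E) in
/-- The quotient map from the algebra of all relations to the algebra of permuted orders. -/
def toPermOrderAlg : RelAlg k E →ₐ[k] PermOrderAlg k E := RingQuot.mkAlgHom k _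

/-- The class of a relation in the algebra of permuted orders. -/
def cls (Q : Set (E × E)) : PermOrderAlg k E := toPermOrderAlg k E (relBasis k Q)

open Classical in
/-- The idempotent `f_R = ∑_{S ⊇ R} μ(R,S) S` of `𝒫_E`, where `S` runs over orders on `E`
and `μ` is the Möbius function of the set of orders on `E`, ordered by inclusion. -/
def fIdem (R : OrderRel E) : PermOrderAlg k E :=
  ∑ S : OrderRel E with R ≤ S, IncidenceAlgebra.mu k R S • cls k S.rel

open Classical in
lemma mu_orderIso {α : Type u} [PartialOrder α] [LocallyFiniteOrder α] (e : α ≃o α) (a b : α) :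
    IncidenceAlgebra.mu k (e a) (e b) = IncidenceAlgebra.mu k a b := by
  suffices H : ∀ (n : ℕ) (b : α), (Finset.Ico a b).card = n →
      IncidenceAlgebra.mu k (e a) (e b) = IncidenceAlgebra.mu k a b from H _ b rfl
  intro n
  induction n using Nat.strong_induction_on with
  | _ n ih =>
    intro b hb
    rw [IncidenceAlgebra.mu_apply, IncidenceAlgebra.mu_apply (a := a)]
    simp only [e.injective.eq_iff]
    congr 2
    refine (Finset.sum_bij (fun x _ => e x) ?_ ?_ ?_ ?_).symm
    · intro x hx; simpa using hx
    · intro x _ y _ h; exact e.injective h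
    · intro y hy
      refine ⟨e.symm y, ?_, by simp⟩
      rw [Finset.mem_Ico] at hy ⊢
      exact ⟨e.le_symm_apply.2 hy.1, e.symm_apply_lt.2 hy.2⟩
    · intro x hx
      refine (ih _ ?_ x rfl).symm
      rw [← hb]
      apply Finset.card_lt_card
      rw [Finset.mem_Ico] at hx
      refine Finset.ssubset_iff_subset_ne.2 ⟨Finset.Ico_subset_Ico_right hx.2.le, fun h => ?_⟩
      have : x ∈ Finset.Ico a x := by rw [h]; exact Finset.mem_Ico.2 hx
      simp at this

lemma relBasis_mul (Q Q' : Set (E × E)) :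
    relBasis k Q * relBasis k Q' =
      relBasis k {p | ∃ y, (p.1, y) ∈ Q ∧ (y, p.2) ∈ Q'} :=
  ((Free.embedding k FinCorr.{u}).map_comp
    (corr (X := FinCorr.mk E) (Y := FinCorr.mk E) Q')
    (corr (X := FinCorr.mk E) (Y := FinCorr.mk E) Q)).symm

lemma cls_mul (Q Q' : Set (E × E)) :
    cls k Q * cls k Q' = cls k {p | ∃ y, (p.1, y) ∈ Q ∧ (y, p.2) ∈ Q'} := by
  unfold cls; rw [← map_mul, relBasis_mul]

lemma cls_order_mul_perm (S : OrderRel E) (σ : Equiv.Perm E) :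
    cls k (S.conj σ).rel * cls k (permRel σ) = cls k (permRel σ) * cls k S.rel := by
  rw [cls_mul, cls_mul]
  congr 1
  ext ⟨x, z⟩
  constructor
  · rintro ⟨y, h1, h2⟩
    change y = σ z at h2
    subst h2
    exact ⟨σ⁻¹ x, by simp [permRel], by simpa [OrderRel.conj] using h1⟩
  · rintro ⟨y, h1, h2⟩
    change x = σ y at h1
    subst h1
    exact ⟨σ z, by simpa [OrderRel.conj] using h2, rfl⟩

lemma fIdem_mul_perm (R : OrderRel E) {τ : Equiv.Perm E} (hτ : τ ∈ R.aut) :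
    fIdem k R * cls k (permRel τ) = cls k (permRel τ) * fIdem k R := by
  classical
  unfold fIdem
  rw [Finset.sum_mul, Finset.mul_sum]
  symm
  refine Finset.sum_bij (fun S _ => OrderRel.conjIso τ S) ?_ ?_ ?_ ?_
  · intro S hS
    rw [Finset.mem_filter] at hS ⊢
    refine ⟨Finset.mem_univ _, ?_⟩
    have := (OrderRel.conjIso τ).monotone hS.2
    rwa [show OrderRel.conjIso τ R = R from R.conj_eq_self hτ] at this
  · intro S _ S' _ h; exact (OrderRel.conjIso τ).injective h
  · intro S hS
    refine ⟨(OrderRel.conjIso τ).symm S, ?_, by simp⟩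
    rw [Finset.mem_filter] at hS ⊢
    refine ⟨Finset.mem_univ _, ?_⟩
    rw [OrderIso.le_symm_apply, show OrderRel.conjIso τ R = R from R.conj_eq_self hτ]
    exact hS.2
  · intro S hS
    have h1 := mu_orderIso k (OrderRel.conjIso τ) R S
    rw [show OrderRel.conjIso τ R = R from R.conj_eq_self hτ] at h1
    have h2 : IncidenceAlgebra.mu k R (OrderRel.conjIso τ S) = IncidenceAlgebra.mu k R S := by
      convert h1
    rw [h2, mul_smul_comm, smul_mul_assoc]
    congr 1
    exact (cls_order_mul_perm k S τ).symm

/-! ### The fundamental module and the simple functors -/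

/-- The fundamental module `𝒫_E f_R`, the left ideal generated by `f_R`. -/
def fundamentalModule (R : OrderRel E) : Submodule (PermOrderAlg k E) (PermOrderAlg k E) :=
  Submodule.span (PermOrderAlg k E) {fIdem k R}

/-- The right action `a ↦ a Δ_τ` of `τ ∈ Aut(E,R)` on `𝒫_E f_R`. -/
def rightAction (R : OrderRel E) (τ : R.aut) :
    fundamentalModule k R →ₗ[PermOrderAlg k E] fundamentalModule k R where
  toFun a := ⟨(a : PermOrderAlg k E) * cls k (permRel (τ : Equiv.Perm E)), by
    obtain ⟨b, hb⟩ := Submodule.mem_span_singleton.1 a.2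
    refine Submodule.mem_span_singleton.2 ⟨b * cls k (permRel (τ : Equiv.Perm E)), ?_⟩
    rw [← hb, smul_eq_mul, smul_eq_mul, mul_assoc, mul_assoc, fIdem_mul_perm k R τ.2]⟩
  map_add' a b := Subtype.ext (add_mul _ _ _)
  map_smul' c a := Subtype.ext (mul_assoc _ _ _)

variable {k} {V : Type u} [AddCommGroup V] [Module k V]

/-- The relations `(a Δ_τ) ⊗ v = a ⊗ (τ • v)` for `τ ∈ Aut(E,R)`. -/
def TRel (R : OrderRel E) (ρ : Representation k R.aut V) :
    Submodule (PermOrderAlg k E) (fundamentalModule k R ⊗[k] V) :=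
  Submodule.span (PermOrderAlg k E) {t | ∃ (a : fundamentalModule k R) (τ : R.aut) (v : V),
    t = rightAction k R τ a ⊗ₜ[k] v - a ⊗ₜ[k] ρ τ v}

/-- The left `𝒫_E`-module `T_{R,V} = 𝒫_E f_R ⊗_{k Aut(E,R)} V`, with `V` given as a
`k`-linear representation of `Aut(E,R)`. -/
abbrev TModule (R : OrderRel E) (ρ : Representation k R.aut V) : Type u :=
  (fundamentalModule k R ⊗[k] V) ⧸ TRel R ρ

/-- `T_{R,V}` as a module over the algebra of all relations, via `k𝒞(E,E) → 𝒫_E`. -/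
instance (R : OrderRel E) (ρ : Representation k R.aut V) :
    Module (RelAlg k E) (TModule R ρ) :=
  Module.compHom _ (toPermOrderAlg k E).toRingHom

instance (R : OrderRel E) (ρ : Representation k R.aut V) :
    IsScalarTower k (RelAlg k E) (TModule R ρ) where
  smul_assoc c a x := by
    change toPermOrderAlg k E (c • a) • x = c • (toPermOrderAlg k E a • x)
    rw [map_smul, smul_assoc]

/-- The correspondence functor `S_{E,R,V} = L_{E,T_{R,V}} / J_{E,T_{R,V}}`. -/
def simpleFunctor (R : OrderRel E) (ρ : Representation k R.aut V) : CorrespondenceFunctor k :=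
  quotientFunctor k E (TModule R ρ)

/-- The dual of a `k Aut(E,R)`-module, `(τ • α)(v) = α(τ⁻¹ • v)`,
as a module for `Aut(E,R^op) = Aut(E,R)`. -/
def dualRep (R : OrderRel E) (ρ : Representation k R.aut V) :
    Representation k R.op.aut (Module.Dual k V) :=
  ρ.dual.comp R.autOp

end PermutedOrders

end CorrespondenceFunctors

end

noncomputable section

namespace CorrespondenceFunctors

/-! ### Duality between the functors `L_{E,W} / J_{E,W}` -/

section OppInvolutive

variable {k : Type u} [CommRing k] {X Y : LinCorr k}

/-! The construction `L_{E,W} / J_{E,W}` turns dual modules into dual functors. Let `B : W × W' → k`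
make each relation adjoint to its opposite. Then `⟨φ' ⊗ w', φ ⊗ w⟩ = B((φ'^op φ) w, w')` pairs
`L_{E,W'}(X)` with `L_{E,W}(X)` and makes each morphism `f` adjoint to `f^op`. If `B` is
nondegenerate, the kernels on the two sides are exactly the two submodules `J`. The quotients are
then paired nondegenerately, and in finite dimension this is a natural isomorphism
(`dualQuotientFunctorIso`).

It remains to pair `T_{R,V}` with `T_{R^op,V^♮}`. The module `𝒫_E f_R` has the `k`-basis `Δ_σ f_R`.
These elements span because an essential relation is some `Δ_σ` times a reflexive relation
(`exists_perm_of_not_inessential`), the class of the latter is zero or an order, and an order fixes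
or kills `f_R` (`cls_mul_fIdem`). In this basis the entry of `Q` at `(π, σ)` is 1 if `Δ ⊆ Δ_{π⁻¹} Q
Δ_σ ⊆ R`, and 0 otherwise. This condition is symmetric: replacing `Q`, `R` by their opposites and
exchanging `π`, `σ` changes nothing. Hence `Q^op` acts on `𝒫_E f_{R^op}` by the transpose of the
matrix of `Q` on `𝒫_E f_R` (`permMatrix_algOpp`). The matrices are shown directly to represent `𝒫_E`
(`relMatrix_mul`, `permMatrix`), which also gives linear independence.

With coefficients, `TFun` identifies `T_{R,V}` with the functions `h` such that `h(πτ) = τ⁻¹ h(π)`,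
and `b ⊗ α` pairs with `h` to give `∑ b_π α(h(π))`. The sum over the automorphism group is taken on
one side only, so its order is never inverted and the characteristic plays no role. Irreducibility
of `V` enters through finite-dimensionality. -/

lemma linOpp_linOpp (f : X ⟶ Y) : linOpp (linOpp f) = f := by
  refine hom_induction (P := fun f => linOpp (linOpp f) = f) f (by simp) (fun f g hf hg => ?_)
    (fun Q c => ?_)
  · rw [map_add, map_add, hf, hg]
  · exact (congrArg linOpp (linOpp_single (k := k) X Y Q c)).trans (linOpp_single _ _ _ c)

variable {E : Type u} [Finite E]

/-- The anti-automorphism of the algebra of all relations that sends a relation to its opposite. -/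
def algOpp (a : RelAlg k E) : RelAlg k E :=
  linOpp (show LinCorr.of k E ⟶ LinCorr.of k E from a)

lemma algOpp_algOpp (a : RelAlg k E) : algOpp (algOpp a) = a := linOpp_linOpp _

end OppInvolutive

/-! ### Invariant pairings of modules and the pairings of functors they induce. -/

section Pairing

variable (k : Type u) [CommRing k] (E : Type u) [Finite E]
variable {W W' : Type u} [AddCommGroup W] [Module k W] [Module (RelAlg k E) W]
  [IsScalarTower k (RelAlg k E) W]
  [AddCommGroup W'] [Module k W'] [Module (RelAlg k E) W'] [IsScalarTower k (RelAlg k E) W']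

lemma LEval_mk {X : LinCorr k} (ψ : X ⟶ LinCorr.of k E) (φ : LinCorr.of k E ⟶ X) (w : W) :
    LEval k E W ψ (Submodule.Quotient.mk (φ ⊗ₜ[k] w)) = (show RelAlg k E from φ ≫ ψ) • w := rfl

lemma LEval_add {X : LinCorr k} (ψ ψ' : X ⟶ LinCorr.of k E) (x : LObj k E W X) :
    LEval k E W (ψ + ψ') x = LEval k E W ψ x + LEval k E W ψ' x := by
  obtain ⟨x, rfl⟩ := Submodule.Quotient.mk_surjective _ x
  induction x using TensorProduct.induction_on with
  | zero => simp
  | tmul φ w =>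
    rw [LEval_mk, LEval_mk, LEval_mk, Preadditive.comp_add]; exact add_smul _ _ _
  | add x y hx hy =>
    simp only [Submodule.Quotient.mk_add, map_add, hx, hy]; abel

lemma LEval_smul {X : LinCorr k} (c : k) (ψ : X ⟶ LinCorr.of k E) (x : LObj k E W X) :
    LEval k E W (c • ψ) x = c • LEval k E W ψ x := by
  obtain ⟨x, rfl⟩ := Submodule.Quotient.mk_surjective _ x
  induction x using TensorProduct.induction_on with
  | zero => simp
  | tmul φ w =>
    rw [LEval_mk, LEval_mk, Linear.comp_smul]; exact smul_assoc c (show RelAlg k E from φ ≫ ψ) w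
  | add x y hx hy => simp only [Submodule.Quotient.mk_add, map_add, smul_add, hx, hy]

lemma LEval_comp {X : LinCorr k} (ψ : X ⟶ LinCorr.of k E)
    (a : LinCorr.of k E ⟶ LinCorr.of k E) (x : LObj k E W X) :
    LEval k E W (ψ ≫ a) x = (show RelAlg k E from a) • LEval k E W ψ x := by
  obtain ⟨x, rfl⟩ := Submodule.Quotient.mk_surjective _ x
  induction x using TensorProduct.induction_on with
  | zero => simp
  | tmul φ w =>
    rw [LEval_mk, LEval_mk, ← mul_smul, ← Category.assoc]; rfl
  | add x y hx hy => simp only [Submodule.Quotient.mk_add, map_add, smul_add, hx, hy]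

variable {k E} (B : W →ₗ[k] W' →ₗ[k] k)

/-- A pairing for which the action of a relation is adjoint to that of its opposite. -/
def OppInvariant : Prop :=
  ∀ (a : RelAlg k E) (w : W) (w' : W'), B (a • w) w' = B w (algOpp a • w')

/-- The pairing of `L_{E,W}(X)` and `L_{E,W'}(X)` with
`⟨x, φ' ⊗ w'⟩ = B (φ'^op x, w')`. -/
def LPairing (hB : OppInvariant (E := E) B) (X : LinCorr k) :
    LObj k E W' X →ₗ[k] LObj k E W X →ₗ[k] k :=
  Submodule.liftQ _
    (TensorProduct.lift (LinearMap.mk₂ k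
      (fun (φ : LinCorr.of k E ⟶ X) (w' : W') => (B.flip w') ∘ₗ LEval k E W (linOpp φ))
      (fun φ φ' w => by
        apply LinearMap.ext; intro x
        simp [LEval_add])
      (fun c φ w => by
        apply LinearMap.ext; intro x
        simp [LEval_smul])
      (fun φ w w' => by
        apply LinearMap.ext; intro x
        simp)
      (fun c φ w => by
        apply LinearMap.ext; intro x
        simp)))
    (by
      rw [tensorRel, Submodule.span_le]
      rintro _ ⟨φ, a, w, rfl⟩
      change _ = _
      rw [map_sub, sub_eq_zero, TensorProduct.lift.tmul, TensorProduct.lift.tmul]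
      apply LinearMap.ext; intro x
      change B (LEval k E W (linOpp (_ ≫ φ)) x) w = B (LEval k E W (linOpp φ) x) (a • w)
      rw [linOpp_comp, LEval_comp]
      refine (hB (algOpp a) _ _).trans ?_
      rw [algOpp_algOpp])

variable (hB : OppInvariant (E := E) B) {X Y : LinCorr k}

lemma LPairing_mk (φ : LinCorr.of k E ⟶ X) (w' : W') (x : LObj k E W X) :
    LPairing B hB X (Submodule.Quotient.mk (φ ⊗ₜ[k] w')) x =
      B (LEval k E W (linOpp φ) x) w' := rfl

/-- Invariance of `B` makes the pairing symmetric in its two sides, although it was defined by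
evaluating only the side of `W`. This allows the kernel to be computed on either side. -/
lemma LPairing_mk_right (φ : LinCorr.of k E ⟶ X) (w : W) (x' : LObj k E W' X) :
    LPairing B hB X x' (Submodule.Quotient.mk (φ ⊗ₜ[k] w)) =
      B w (LEval k E W' (linOpp φ) x') := by
  obtain ⟨x', rfl⟩ := Submodule.Quotient.mk_surjective _ x'
  induction x' using TensorProduct.induction_on with
  | zero => simp
  | tmul φ' w' =>
    rw [LPairing_mk, LEval_mk, LEval_mk]
    refine (hB _ _ _).trans ?_
    congr 2
    refine (linOpp_comp φ (linOpp φ')).trans ?_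
    rw [linOpp_linOpp]
  | add x y hx hy =>
    simp only [Submodule.Quotient.mk_add, map_add, LinearMap.add_apply, hx, hy]

lemma LPairing_LMap (f : X ⟶ Y) (x' : LObj k E W' X) (y : LObj k E W Y) :
    LPairing B hB Y (LMap k E W' f x') y = LPairing B hB X x' (LMap k E W (linOpp f) y) := by
  obtain ⟨x', rfl⟩ := Submodule.Quotient.mk_surjective _ x'
  induction x' using TensorProduct.induction_on with
  | zero => simp
  | tmul φ' w' =>
    rw [LPairing_mk, LEval_LMap, ← linOpp_comp]; rfl
  | add x y hx hy =>
    simp only [Submodule.Quotient.mk_add, map_add, LinearMap.add_apply, hx, hy]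

lemma LPairing_eq_zero_of_mem_left {x' : LObj k E W' X} (hx : x' ∈ JObj k E W' X) :
    LPairing B hB X x' = 0 := by
  apply Submodule.linearMap_qext
  apply TensorProduct.ext'
  intro φ w
  refine (LPairing_mk_right B hB φ w x').trans ?_
  rw [LinearMap.mem_ker.1 ((Submodule.mem_iInf _).1 hx (linOpp φ)), map_zero]; rfl

lemma LPairing_eq_zero_of_mem_right (x' : LObj k E W' X) {x : LObj k E W X}
    (hx : x ∈ JObj k E W X) : LPairing B hB X x' x = 0 := by
  obtain ⟨x', rfl⟩ := Submodule.Quotient.mk_surjective _ x'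
  induction x' using TensorProduct.induction_on with
  | zero => simp
  | tmul φ' w' =>
    rw [LPairing_mk, LinearMap.mem_ker.1 ((Submodule.mem_iInf _).1 hx (linOpp φ')), map_zero]; rfl
  | add x y hx hy =>
    simp only [Submodule.Quotient.mk_add, map_add, LinearMap.add_apply, hx, hy, add_zero]

/-- The pairing of `L_{E,W'}(X) / J_{E,W'}(X)` and `L_{E,W}(X) / J_{E,W}(X)` induced by `B`. -/
def SPairing (X : LinCorr k) :
    (LObj k E W' X ⧸ JObj k E W' X) →ₗ[k] (LObj k E W X ⧸ JObj k E W X) →ₗ[k] k :=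
  Submodule.liftQ _
    (LinearMap.flip (Submodule.liftQ (JObj k E W X) (LPairing B hB X).flip (fun x hx => by
      rw [LinearMap.mem_ker]
      apply LinearMap.ext; intro x'
      exact LPairing_eq_zero_of_mem_right B hB x' hx)))
    (fun x' hx => by
      rw [LinearMap.mem_ker]
      apply Submodule.linearMap_qext
      apply LinearMap.ext; intro x
      exact LinearMap.congr_fun (LPairing_eq_zero_of_mem_left B hB hx) x)

lemma SPairing_mk (x' : LObj k E W' X) (x : LObj k E W X) :
    SPairing B hB X (Submodule.Quotient.mk x') (Submodule.Quotient.mk x) =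
      LPairing B hB X x' x := rfl

lemma SPairing_SMap (f : X ⟶ Y) (x' : LObj k E W' X ⧸ JObj k E W' X)
    (y : LObj k E W Y ⧸ JObj k E W Y) :
    SPairing B hB Y (SMap k E W' f x') y = SPairing B hB X x' (SMap k E W (linOpp f) y) := by
  obtain ⟨x', rfl⟩ := Submodule.Quotient.mk_surjective _ x'
  obtain ⟨y, rfl⟩ := Submodule.Quotient.mk_surjective _ y
  exact LPairing_LMap B hB f x' y

/-- Pairing `x'` with `ψ^op ⊗ w` gives `B(w, ψ x')`, so an `x'` orthogonal to everything satisfies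
`ψ x' = 0` for all `ψ`, the condition defining `J`. -/
lemma SPairing_injective (hR : B.SeparatingRight) : Function.Injective (SPairing B hB X) := by
  rw [injective_iff_map_eq_zero]
  intro x' h
  obtain ⟨x', rfl⟩ := Submodule.Quotient.mk_surjective _ x'
  rw [Submodule.Quotient.mk_eq_zero, JObj, Submodule.mem_iInf]
  intro ψ
  rw [LinearMap.mem_ker]
  refine hR _ (fun w => ?_)
  have := LinearMap.congr_fun h
    (Submodule.Quotient.mk (Submodule.Quotient.mk (linOpp ψ ⊗ₜ[k] w)))
  rw [SPairing_mk, LPairing_mk_right, linOpp_linOpp] at this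
  exact this

lemma SPairing_flip_injective (hL : B.SeparatingLeft) :
    Function.Injective (SPairing B hB X).flip := by
  rw [injective_iff_map_eq_zero]
  intro x h
  obtain ⟨x, rfl⟩ := Submodule.Quotient.mk_surjective _ x
  rw [Submodule.Quotient.mk_eq_zero, JObj, Submodule.mem_iInf]
  intro ψ
  rw [LinearMap.mem_ker]
  refine hL _ (fun w' => ?_)
  have := LinearMap.congr_fun h
    (Submodule.Quotient.mk (Submodule.Quotient.mk (linOpp ψ ⊗ₜ[k] w')))
  rw [LinearMap.flip_apply, SPairing_mk, LPairing_mk, linOpp_linOpp] at this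
  exact this

end Pairing

/-! ### Perfect duality over a field. -/

section Field

variable {k : Type u} [Field k] {E : Type u} [Finite E]
variable {W W' : Type u} [AddCommGroup W] [Module k W] [Module (RelAlg k E) W]
  [IsScalarTower k (RelAlg k E) W]
  [AddCommGroup W'] [Module k W'] [Module (RelAlg k E) W'] [IsScalarTower k (RelAlg k E) W']

instance finite_hom (X Y : LinCorr k) : Module.Finite k (X ⟶ Y) := by
  have : Finite (@Quiver.Hom FinCorr.{u} _ X Y) := by
    have := FinCorr.finite X
    have := FinCorr.finite Y
    exact inferInstanceAs (Finite (Set (FinCorr.carrier Y × FinCorr.carrier X)))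
  exact inferInstanceAs (Module.Finite k (@Quiver.Hom FinCorr.{u} _ X Y →₀ k))

/-- Two finite-dimensional modules in duality over the algebra of all relations give dual
correspondence functors. -/
def dualQuotientFunctorIso [Module.Finite k W] (B : W →ₗ[k] W' →ₗ[k] k)
    (hB : OppInvariant (E := E) B) (hL : B.SeparatingLeft) (hR : B.SeparatingRight) :
    dualFunctor (quotientFunctor k E W) ≅ quotientFunctor k E W' :=
  ObjectProperty.isoMk _ (Iso.symm (NatIso.ofComponents
    (fun X =>
      have := LinearMap.IsPerfPair.of_injective' (SPairing_injective B hB (X := X) hR)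
        (SPairing_flip_injective B hB hL)
      (SPairing B hB X).toPerfPair.toModuleIso)
    (fun f => by
      apply ModuleCat.hom_ext
      apply LinearMap.ext; intro x'
      apply LinearMap.ext; intro y
      exact SPairing_SMap B hB f x' y)))

end Field

/-! ### Generators of the fundamental module -/

section Relations

variable {E : Type u}

lemma subset_transClosure (S : Set (E × E)) : S ⊆ transClosure S :=
  fun _ h => Relation.TransGen.single h

lemma transClosure_subset {S T : Set (E × E)} (h : S ⊆ T)
    (hT : ∀ x y z, (x, y) ∈ T → (y, z) ∈ T → (x, z) ∈ T) : transClosure S ⊆ T := by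
  rintro ⟨x, y⟩ hxy
  change Relation.TransGen _ x y at hxy
  induction hxy with
  | single h' => exact h h'
  | tail _ h' ih => exact hT _ _ _ ih (h h')

lemma transClosure_trans (S : Set (E × E)) (x y z : E) (h : (x, y) ∈ transClosure S)
    (h' : (y, z) ∈ transClosure S) : (x, z) ∈ transClosure S :=
  Relation.TransGen.trans h h'

variable [Finite E]

lemma inessential_iff {Q : Set (E × E)} : Inessential Q ↔
    ∃ (Y : Type u) (_ : Finite Y) (f : Set (Y × E)) (g : Set (E × Y)),
      Nat.card Y < Nat.card E ∧ ∀ a b, (a, b) ∈ Q ↔ ∃ y, (a, y) ∈ g ∧ (y, b) ∈ f := by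
  constructor
  · rintro ⟨Y, f, g, h, rfl⟩
    exact ⟨Y, Y.finite, f, g, h, fun a b => Iff.rfl⟩
  · rintro ⟨Y, _, f, g, h, hQ⟩
    refine ⟨FinCorr.mk Y, f, g, h, ?_⟩
    ext ⟨a, b⟩
    exact (hQ a b).symm

/-- A preorder which is not antisymmetric is inessential. -/
lemma inessential_of_not_antisymm {S : Set (E × E)} (hr : ∀ x, (x, x) ∈ S)
    (ht : ∀ x y z, (x, y) ∈ S → (y, z) ∈ S → (x, z) ∈ S) {x y : E} (hxy : (x, y) ∈ S)
    (hyx : (y, x) ∈ S) (hne : x ≠ y) : Inessential S := by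
  -- Since `x` and `y` are equivalent, a path through `y` can go through `x` instead, so `S = S ∘ S`
  -- still factors after `y` is removed.
  refine inessential_iff.2 ⟨{z : E // z ≠ y}, inferInstance, {p | (p.1.1, p.2) ∈ S},
    {p | (p.1, p.2.1) ∈ S}, Finite.card_subtype_lt (x := y) (by simp), fun a b => ⟨fun h => ?_, ?_⟩⟩
  · by_cases hb : b = y
    · subst hb
      exact ⟨⟨x, hne⟩, ht _ _ _ h hyx, hxy⟩
    · exact ⟨⟨b, hb⟩, h, hr b⟩
  · rintro ⟨z, hz, hz'⟩
    exact ht _ _ _ hz hz'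

/-- By Hall's marriage theorem, an essential relation contains a permutation. -/
lemma exists_perm_of_not_inessential {Q : Set (E × E)} (hQ : ¬ Inessential Q) :
    ∃ σ : Equiv.Perm E, ∀ x, (σ x, x) ∈ Q := by
  classical
  have := Fintype.ofFinite E
  by_contra hne
  apply hQ
  have hall := mt (Fintype.all_card_le_filter_rel_iff_exists_injective
    (fun x y : E => (y, x) ∈ Q)).1 (by
      rintro ⟨f, hf, hf'⟩
      exact hne ⟨Equiv.ofBijective f (Finite.injective_iff_bijective.1 hf), hf'⟩)
  push Not at hall
  obtain ⟨s, hs⟩ := hall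
  set N : Finset E := {b | ∃ a ∈ s, (b, a) ∈ Q} with hN
  -- If `s` violates Hall's condition, pairs `(a, b)` with `b ∈ s` factor through the neighbours `N`
  -- of `s`, and the others through `b` itself. The middle set has `|N| + |E| - |s| < |E|` elements.
  refine inessential_iff.2 ⟨{y // y ∈ N} ⊕ {x // x ∈ sᶜ}, inferInstance,
    {p | Sum.elim (fun y => p.2 ∈ s ∧ (y.1, p.2) ∈ Q) (fun x => x.1 = p.2) p.1},
    {p | Sum.elim (fun y => p.1 = y.1) (fun x => (p.1, x.1) ∈ Q) p.2}, ?_, fun a b => ⟨fun h => ?_, ?_⟩⟩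
  · rw [Nat.card_eq_fintype_card, Nat.card_eq_fintype_card, Fintype.card_sum, Fintype.card_coe,
      Fintype.card_coe, Finset.card_compl]
    have := Finset.card_le_univ s
    omega
  · by_cases hb : b ∈ s
    · exact ⟨Sum.inl ⟨a, by rw [hN, Finset.mem_filter]; exact ⟨Finset.mem_univ _, b, hb, h⟩⟩,
        rfl, hb, h⟩
    · exact ⟨Sum.inr ⟨b, by simpa using hb⟩, h, rfl⟩
  · rintro ⟨y | x, h, h'⟩
    · change a = y.1 at h
      subst h
      exact h'.2
    · change x.1 = b at h'
      subst h'
      exact h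

end Relations

/-! ### Products of orders and the idempotents `f_R` in the algebra of permuted orders. -/

section Classes

variable (k : Type u) [CommRing k] {E : Type u} [Finite E]

lemma cls_inessential {Q : Set (E × E)} (hQ : Inessential Q) : cls k Q = 0 :=
  (RingQuot.mkAlgHom_rel k (PermutedOrderRel.inessential Q hQ)).trans (map_zero _)

lemma cls_transClosure {S : Set (E × E)} (hS : ∀ x, (x, x) ∈ S) :
    cls k (transClosure S) = cls k S :=
  (RingQuot.mkAlgHom_rel k (PermutedOrderRel.closure S hS)).symm

lemma toPermOrderAlg_surjective : Function.Surjective (toPermOrderAlg k E) :=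
  RingQuot.mkAlgHom_surjective k _

/-- The class of a reflexive relation is either zero or the class of the order it generates. -/
lemma cls_reflexive {S : Set (E × E)} (hS : ∀ x, (x, x) ∈ S) :
    (∃ U : OrderRel E, U.rel = transClosure S ∧ cls k S = cls k U.rel) ∨
      (cls k S = 0 ∧ ∀ U : OrderRel E, ¬ S ⊆ U.rel) := by
  by_cases h : ∀ x y, (x, y) ∈ transClosure S → (y, x) ∈ transClosure S → x = y
  · exact Or.inl ⟨⟨transClosure S, fun x => subset_transClosure S (hS x), h,
      transClosure_trans S⟩, rfl, (cls_transClosure k hS).symm⟩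
  · push Not at h
    obtain ⟨x, y, hxy, hyx, hne⟩ := h
    refine Or.inr ⟨?_, fun U hU => ?_⟩
    · rw [← cls_transClosure k hS]
      exact cls_inessential k (inessential_of_not_antisymm (fun x => subset_transClosure S (hS x))
        (transClosure_trans S) hxy hyx hne)
    · have := transClosure_subset hU U.trans
      exact hne (U.antisymm x y (this hxy) (this hyx))

/-- The product of two orders is the least order containing both if there is one, and zero
otherwise. -/
lemma cls_mul_orders (S R : OrderRel E) :
    (∃ U : OrderRel E, (∀ T, U ≤ T ↔ S ≤ T ∧ R ≤ T) ∧
      cls k S.rel * cls k R.rel = cls k U.rel) ∨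
      (cls k S.rel * cls k R.rel = 0 ∧ ∀ T : OrderRel E, ¬ (S ≤ T ∧ R ≤ T)) := by
  rw [cls_mul]
  set Q : Set (E × E) := {p | ∃ y, (p.1, y) ∈ S.rel ∧ (y, p.2) ∈ R.rel} with hQ
  -- By reflexivity the composite contains both factors, and by transitivity an order containing
  -- both contains the composite.
  have hsub : ∀ T : OrderRel E, Q ⊆ T.rel ↔ S ≤ T ∧ R ≤ T := by
    refine fun T => ⟨fun h => ⟨?_, ?_⟩, ?_⟩
    · rintro ⟨x, y⟩ hxy; exact h ⟨y, hxy, R.refl y⟩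
    · rintro ⟨x, y⟩ hxy; exact h ⟨x, S.refl x, hxy⟩
    · rintro ⟨hS, hR⟩ ⟨x, z⟩ ⟨y, h1, h2⟩; exact T.trans _ _ _ (hS h1) (hR h2)
  rcases cls_reflexive k (S := Q) (fun x => ⟨x, S.refl x, R.refl x⟩) with ⟨U, hU, hc⟩ | ⟨h0, hU⟩
  · refine Or.inl ⟨U, fun T => ?_, hc⟩
    rw [← hsub]
    constructor
    · intro h; exact (subset_transClosure Q).trans (hU ▸ h : transClosure Q ⊆ T.rel)
    · intro h; change U.rel ⊆ T.rel; rw [hU]; exact transClosure_subset h T.trans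
  · exact Or.inr ⟨h0, fun T hT => hU T ((hsub T).2 hT)⟩

open Classical in
/-- Möbius inversion: an order is the sum of the idempotents of the orders containing it. -/
lemma sum_fIdem (R : OrderRel E) : ∑ T : OrderRel E with R ≤ T, fIdem k T = cls k R.rel := by
  unfold fIdem
  simp_rw [Finset.sum_filter]
  have : ∀ T : OrderRel E, (if R ≤ T then
      ∑ S : OrderRel E, (if T ≤ S then IncidenceAlgebra.mu k T S • cls k S.rel else 0) else 0) =
      ∑ S : OrderRel E, (if R ≤ T ∧ T ≤ S then IncidenceAlgebra.mu k T S else 0) • cls k S.rel := by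
    intro T
    split_ifs with h
    · refine Finset.sum_congr rfl fun S _ => ?_
      simp only [h, true_and, ite_smul, zero_smul]
    · simp [h]
  rw [Finset.sum_congr rfl fun T _ => this T, Finset.sum_comm]
  simp_rw [← Finset.sum_smul]
  -- The coefficient of `S` is now the sum of `μ(T, S)` over `R ≤ T ≤ S`, which is 1 for `S = R` and
  -- 0 otherwise.
  rw [Finset.sum_eq_single R]
  · rw [← Finset.sum_filter]
    have h := IncidenceAlgebra.sum_Icc_mu_left (𝕜 := k) R R
    rw [if_pos rfl] at h
    rw [show (Finset.univ.filter fun T : OrderRel E => R ≤ T ∧ T ≤ R) = Finset.Icc R R by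
      ext; simp only [Finset.mem_filter, Finset.mem_univ, true_and, Finset.mem_Icc], h, one_smul]
  · intro S _ hS
    rw [← Finset.sum_filter]
    have h := IncidenceAlgebra.sum_Icc_mu_left (𝕜 := k) R S
    rw [if_neg hS.symm] at h
    rw [show (Finset.univ.filter fun T : OrderRel E => R ≤ T ∧ T ≤ S) = Finset.Icc R S by
      ext; simp only [Finset.mem_filter, Finset.mem_univ, true_and, Finset.mem_Icc], h, zero_smul]
  · intro h; exact absurd (Finset.mem_univ _) h

open Classical in
-- This recursive form is suited to induction from the maximal orders downwards.
lemma fIdem_eq (R : OrderRel E) :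
    fIdem k R = cls k R.rel - ∑ T : OrderRel E with R < T, fIdem k T := by
  rw [← sum_fIdem k R, eq_sub_iff_add_eq]
  rw [show (Finset.univ.filter fun T : OrderRel E => R ≤ T) =
    insert R (Finset.univ.filter fun T => R < T) by
      ext T; simp [le_iff_eq_or_lt, eq_comm], Finset.sum_insert (by simp)]

open Classical in
/-- An order `S` acts on `f_R` as `1` if `S ⊆ R` and as `0` otherwise. -/
lemma cls_mul_fIdem (S R : OrderRel E) :
    cls k S.rel * fIdem k R = if S ≤ R then fIdem k R else 0 := by
  induction R using WellFoundedGT.induction with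
  | _ R ih =>
  have key : cls k S.rel * fIdem k R = cls k S.rel * cls k R.rel -
      ∑ T : OrderRel E with R < T ∧ S ≤ T, fIdem k T := by
    rw [fIdem_eq, mul_sub, Finset.mul_sum, ← Finset.filter_filter]
    congr 1
    rw [Finset.sum_congr rfl fun T hT => ih T (Finset.mem_filter.1 hT).2]
    rw [Finset.sum_filter (fun T => S ≤ T)]
  rw [key]
  -- If `S` and `R` have a join `U`, then `S R = U` is the sum of `f_T` over all `T` above both. The
  -- subtracted sum omits only `T = R`, which occurs exactly when `S ≤ R`. Without a common upper
  -- bound everything vanishes.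
  rcases cls_mul_orders k S R with ⟨U, hU, hc⟩ | ⟨h0, hT⟩
  · rw [hc]
    split_ifs with h
    · have : U = R := le_antisymm ((hU R).2 ⟨h, le_rfl⟩) ((hU U).1 le_rfl).2
      rw [this, fIdem_eq k R]
      congr 2
      ext T
      simp only [Finset.mem_filter, Finset.mem_univ, true_and]
      exact ⟨fun h => h.1, fun hT => ⟨hT, h.trans hT.le⟩⟩
    · rw [← sum_fIdem, sub_eq_zero]
      congr 1
      ext T
      simp only [Finset.mem_filter, Finset.mem_univ, true_and, hU]
      refine ⟨fun hT => ⟨lt_of_le_of_ne hT.2 ?_, hT.1⟩, fun hT => ⟨hT.2, hT.1.le⟩⟩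
      rintro rfl
      exact h hT.1
  · rw [h0, if_neg (fun h => hT R ⟨h, le_rfl⟩), Finset.filter_false_of_mem
      (fun T _ hT' => hT T ⟨hT'.2, hT'.1.le⟩), Finset.sum_empty, sub_zero]

/-- An essential `Q` contains some `Δ_σ`, hence is `Δ_σ` times a reflexive relation; that relation
is zero or an order in `𝒫_E`, and so multiplies `f_R` by 0 or 1. -/
lemma cls_mul_fIdem_mem (Q : Set (E × E)) (R : OrderRel E) :
    cls k Q * fIdem k R ∈
      Submodule.span k (Set.range fun σ : Equiv.Perm E => cls k (permRel σ) * fIdem k R) := by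
  classical
  by_cases hQ : Inessential Q
  · rw [cls_inessential k hQ, zero_mul]; exact zero_mem _
  obtain ⟨σ, hσ⟩ := exists_perm_of_not_inessential hQ
  have hmul : cls k Q = cls k (permRel σ) * cls k {p : E × E | (σ p.1, p.2) ∈ Q} := by
    rw [cls_mul]
    congr 1
    ext ⟨x, z⟩
    constructor
    · intro h; exact ⟨σ⁻¹ x, by simp [permRel], by simpa using h⟩
    · rintro ⟨y, h1, h2⟩
      change x = σ y at h1
      subst h1; exact h2
  rcases cls_reflexive k (S := {p : E × E | (σ p.1, p.2) ∈ Q}) hσ with ⟨U, -, hU⟩ | ⟨h0, -⟩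
  · rw [hmul, hU, mul_assoc, cls_mul_fIdem]
    split_ifs
    · exact Submodule.subset_span ⟨σ, rfl⟩
    · rw [mul_zero]; exact zero_mem _
  · rw [hmul, h0, mul_zero, zero_mul]; exact zero_mem _

lemma relAlg_induction {P : RelAlg k E → Prop} (a : RelAlg k E) (zero : P 0)
    (add : ∀ a b, P a → P b → P (a + b)) (smul : ∀ (c : k) (Q : Set (E × E)), P (c • relBasis k Q)) :
    P a := by
  refine hom_induction (k := k) (P := P) a zero add (fun Q c => ?_)
  convert smul c Q
  exact (Finsupp.smul_single_one Q c).symm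

/-- The class of a permutation, as a generator `Δ_σ f_R` of the fundamental module. -/
def permGen (R : OrderRel E) (σ : Equiv.Perm E) : fundamentalModule k R :=
  ⟨cls k (permRel σ) * fIdem k R, Submodule.mem_span_singleton.2 ⟨_, rfl⟩⟩

lemma span_permGen (R : OrderRel E) :
    Submodule.span k (Set.range (permGen k R)) = ⊤ := by
  rw [eq_top_iff]
  rintro ⟨a, ha⟩ -
  have : a ∈ Submodule.span k
      (Set.range fun σ : Equiv.Perm E => cls k (permRel σ) * fIdem k R) := by
    obtain ⟨b, rfl⟩ := Submodule.mem_span_singleton.1 ha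
    obtain ⟨b, rfl⟩ := toPermOrderAlg_surjective k b
    rw [smul_eq_mul]
    clear ha
    induction b using relAlg_induction with
    | zero => rw [map_zero, zero_mul]; exact zero_mem _
    | add a b h h' => rw [map_add, add_mul]; exact add_mem h h'
    | smul c Q =>
      rw [map_smul, smul_mul_assoc]
      exact Submodule.smul_mem _ _ (cls_mul_fIdem_mem k Q R)
  have hmap : (Submodule.span k (Set.range (permGen k R))).map
      ((fundamentalModule k R).subtype.restrictScalars k) = Submodule.span k
      (Set.range fun σ : Equiv.Perm E => cls k (permRel σ) * fIdem k R) := by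
    rw [Submodule.map_span, ← Set.range_comp]; rfl
  rw [← hmap] at this
  obtain ⟨b, hb, hba⟩ := this
  rwa [show b = ⟨a, ha⟩ from Subtype.ext hba] at hb

instance (R : OrderRel E) : Module.Finite k (fundamentalModule k R) :=
  ⟨Submodule.fg_def.2 ⟨_, Set.finite_range (permGen k R), span_permGen k R⟩⟩

lemma rightAction_permGen (R : OrderRel E) (τ : R.aut) (σ : Equiv.Perm E) :
    rightAction k R τ (permGen k R σ) = permGen k R (σ * (τ : Equiv.Perm E)) := by
  apply Subtype.ext
  change cls k (permRel σ) * fIdem k R * cls k (permRel (τ : Equiv.Perm E)) =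
    cls k (permRel (σ * (τ : Equiv.Perm E))) * fIdem k R
  rw [mul_assoc, fIdem_mul_perm k R τ.2, ← mul_assoc, cls_mul]
  congr 2
  ext ⟨x, z⟩
  simp [permRel]

end Classes

/-! ### The matrix representation attached to an order -/

section MatrixRepresentation

open scoped Classical

variable {E : Type u}

/-- The relation `{(a, b) | (π a, σ b) ∈ Q}` is reflexive and contained in the order `R`. -/
def Between (R : OrderRel E) (Q : Set (E × E)) (π σ : Equiv.Perm E) : Prop :=
  (∀ z, (π z, σ z) ∈ Q) ∧ ∀ a b, (π a, σ b) ∈ Q → (a, b) ∈ R.rel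

lemma Between.op {R : OrderRel E} {Q : Set (E × E)} {π σ : Equiv.Perm E} :
    Between R.op {p | (p.2, p.1) ∈ Q} σ π ↔ Between R Q π σ :=
  ⟨fun h => ⟨h.1, fun a b => h.2 b a⟩, fun h => ⟨h.1, fun a b => h.2 b a⟩⟩

lemma Between.mul_aut {R : OrderRel E} {Q : Set (E × E)} {π σ τ : Equiv.Perm E}
    (hτ : τ ∈ R.aut) : Between R Q (π * τ) (σ * τ) ↔ Between R Q π σ := by
  constructor
  · refine fun h => ⟨fun z => ?_, fun a b hab => ?_⟩
    · simpa using h.1 (τ⁻¹ z)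
    · have := h.2 (τ⁻¹ a) (τ⁻¹ b) (by simpa using hab)
      exact (R.aut.inv_mem hτ a b).1 this
  · exact fun h => ⟨fun z => h.1 (τ z), fun a b hab => (hτ a b).1 (h.2 _ _ hab)⟩

/-- The action of a relation on the fundamental module, in the basis `Δ_σ f_R`. -/
def relMatrix (k : Type u) [CommRing k] (R : OrderRel E) (Q : Set (E × E)) : Matrix (Equiv.Perm E) (Equiv.Perm E) k :=
  Matrix.of fun π σ => if Between R Q π σ then 1 else 0

lemma relMatrix_apply (k : Type u) [CommRing k] (R : OrderRel E) (Q : Set (E × E)) (π σ : Equiv.Perm E) :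
    relMatrix k R Q π σ = if Between R Q π σ then 1 else 0 := rfl

variable [Finite E]

instance : Fintype (Equiv.Perm E) := Fintype.ofFinite _

instance (R : OrderRel E) : Fintype R.aut := Fintype.ofFinite _

instance (R : OrderRel E) : Fintype (Equiv.Perm E ⧸ R.aut) := Fintype.ofFinite _

/-- A permutation of a finite poset that moves no element down is the identity. -/
lemma perm_eq_one (R : OrderRel E) {σ : Equiv.Perm E} (h : ∀ z, (z, σ z) ∈ R.rel) : σ = 1 := by
  have hn : ∀ (n : ℕ) (z : E), (z, (σ ^ n) z) ∈ R.rel := by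
    intro n
    induction n with
    | zero => exact R.refl
    | succ n ih =>
      intro z
      rw [pow_succ']
      exact R.trans _ _ _ (ih z) (h _)
  ext z
  refine (R.antisymm _ _ (h z) ?_).symm
  -- Going once around the cycle from `σ z` leads back to `z`, which gives the reverse inequality.
  have := hn (orderOf σ - 1) (σ z)
  rwa [← Equiv.Perm.mul_apply, ← pow_succ, Nat.sub_add_cancel (orderOf_pos σ), pow_orderOf_eq_one]
    at this

/-- Choose for each `z` an intermediate point of `(π z, σ z)`. If `z` and `w` share it, then `(π z,
σ w)` and `(π w, σ z)` lie in `Q`, so `z` and `w` are comparable both ways and equal. The choice is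
thus injective. -/
lemma Between.not_inessential {R : OrderRel E} {Q : Set (E × E)} {π σ : Equiv.Perm E}
    (h : Between R Q π σ) : ¬ Inessential Q := by
  intro hQ
  obtain ⟨Y, _, f, g, hlt, hfg⟩ := inessential_iff.1 hQ
  choose y hy hy' using fun z => (hfg _ _).1 (h.1 z)
  refine hlt.not_ge (Nat.card_le_card_of_injective y fun z w hzw => R.antisymm _ _ ?_ ?_)
  · exact h.2 _ _ ((hfg _ _).2 ⟨y z, hy z, hzw ▸ hy' w⟩)
  · exact h.2 _ _ ((hfg _ _).2 ⟨y w, hy w, hzw ▸ hy' z⟩)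

lemma Between.eq_of_reflexive {R : OrderRel E} {S : Set (E × E)} (hS : ∀ x, (x, x) ∈ S)
    {π σ : Equiv.Perm E} (h : Between R S π σ) : π = σ := by
  have : σ⁻¹ * π = 1 := perm_eq_one R fun z => h.2 _ _ (by simpa using hS (π z))
  rw [inv_mul_eq_one] at this
  exact this.symm

/-- Reflexivity forces `π = σ`. The condition then says that `S` lies in a conjugate of `R`, which
is transitive. -/
lemma between_transClosure {R : OrderRel E} {S : Set (E × E)} (hS : ∀ x, (x, x) ∈ S)
    {π σ : Equiv.Perm E} : Between R (transClosure S) π σ ↔ Between R S π σ := by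
  constructor
  · intro h
    obtain rfl := h.eq_of_reflexive fun x => subset_transClosure S (hS x)
    exact ⟨fun z => hS _, fun a b hab => h.2 _ _ (subset_transClosure S hab)⟩
  · intro h
    obtain rfl := h.eq_of_reflexive hS
    have hsub : transClosure S ⊆ (R.conj π).rel := transClosure_subset
      (by rintro ⟨a, b⟩ hab; exact h.2 _ _ (by simpa using hab)) (R.conj π).trans
    refine ⟨fun z => subset_transClosure S (hS _), fun a b hab => ?_⟩
    simpa [OrderRel.conj] using hsub hab

/-- The intermediate points of the pairs `(π z, σ z)` are distinct, by antisymmetry of `R`, and so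
form the permutation `θ`. With `Between.unique` this makes the 0-1 matrices multiplicative in any
characteristic. -/
lemma between_comp {R : OrderRel E} {Q Q' : Set (E × E)} {π σ : Equiv.Perm E} :
    Between R {p | ∃ y, (p.1, y) ∈ Q ∧ (y, p.2) ∈ Q'} π σ ↔
      ∃ θ, Between R Q π θ ∧ Between R Q' θ σ := by
  constructor
  · intro h
    choose y hy hy' using h.1
    have hinj : Function.Injective y := fun z w hzw => R.antisymm _ _
      (h.2 _ _ ⟨y z, hy z, hzw ▸ hy' w⟩) (h.2 _ _ ⟨y w, hy w, hzw ▸ hy' z⟩)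
    refine ⟨Equiv.ofBijective y (Finite.injective_iff_bijective.1 hinj), ⟨hy, fun a b hab => ?_⟩,
      ⟨hy', fun a b hab => ?_⟩⟩
    · exact h.2 _ _ ⟨y b, hab, hy' b⟩
    · exact h.2 _ _ ⟨y a, hy a, hab⟩
  · rintro ⟨θ, h, h'⟩
    refine ⟨fun z => ⟨θ z, h.1 z, h'.1 z⟩, ?_⟩
    rintro a b ⟨y, h1, h2⟩
    obtain ⟨c, rfl⟩ := θ.surjective y
    exact R.trans _ _ _ (h.2 _ _ h1) (h'.2 _ _ h2)

lemma Between.unique {R : OrderRel E} {Q : Set (E × E)} {π θ θ' : Equiv.Perm E}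
    (h : Between R Q π θ) (h' : Between R Q π θ') : θ = θ' := by
  have : θ⁻¹ * θ' = 1 := perm_eq_one R fun z => h.2 _ _ (by simpa using h'.1 z)
  rwa [inv_mul_eq_one] at this

variable (k : Type u) [CommRing k] (R : OrderRel E)

lemma relMatrix_mul (Q Q' : Set (E × E)) :
    relMatrix k R Q * relMatrix k R Q' =
      relMatrix k R {p | ∃ y, (p.1, y) ∈ Q ∧ (y, p.2) ∈ Q'} := by
  ext π σ
  rw [Matrix.mul_apply, relMatrix_apply]
  simp only [relMatrix_apply]
  split_ifs with h
  · obtain ⟨θ, h1, h2⟩ := between_comp.1 h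
    rw [Finset.sum_eq_single θ, if_pos h1, if_pos h2, mul_one]
    · intro θ' _ hne
      rw [if_neg fun h' => hne (Between.unique h' h1), zero_mul]
    · intro h; exact absurd (Finset.mem_univ _) h
  · refine Finset.sum_eq_zero fun θ _ => ?_
    by_cases h1 : Between R Q π θ
    · rw [if_neg fun h2 => h (between_comp.2 ⟨θ, h1, h2⟩), mul_zero]
    · rw [if_neg h1, zero_mul]

lemma relMatrix_one : relMatrix k R {p : E × E | p.1 = p.2} = 1 := by
  ext π σ
  rw [relMatrix_apply, Matrix.one_apply]
  congr 1
  refine propext ⟨fun h => Equiv.ext h.1, ?_⟩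
  rintro rfl
  refine ⟨fun _ => rfl, fun a b hab => ?_⟩
  rw [π.injective hab]; exact R.refl b

/-- The linear extension of `relMatrix` to the algebra of all relations. -/
def relMatrixLin : RelAlg k E →ₗ[k] Matrix (Equiv.Perm E) (Equiv.Perm E) k :=
  (Finsupp.linearCombination k (relMatrix k R) : (Set (E × E) →₀ k) →ₗ[k] _)

lemma relMatrixLin_relBasis (Q : Set (E × E)) :
    relMatrixLin k R (relBasis k Q) = relMatrix k R Q := by
  refine (Finsupp.linearCombination_single k (1 : k) Q).trans ?_
  rw [one_smul]

/-- The matrix representation of the algebra of all relations attached to an order. -/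
def relMatrixHom : RelAlg k E →ₐ[k] Matrix (Equiv.Perm E) (Equiv.Perm E) k :=
  AlgHom.ofLinearMap (relMatrixLin k R)
    ((relMatrixLin_relBasis k R _).trans (relMatrix_one k R))
    (fun a b => by
      induction a using relAlg_induction with
      | zero => simp
      | add a a' h h' => rw [add_mul, map_add, map_add, add_mul, h, h']
      | smul c Q =>
        induction b using relAlg_induction with
        | zero => simp
        | add b b' h h' => rw [mul_add, map_add, map_add, mul_add, h, h']
        | smul c' Q' =>
          simp only [smul_mul_assoc, mul_smul_comm, map_smul, relBasis_mul, relMatrixLin_relBasis,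
            relMatrix_mul])

/-- The matrix representation of the algebra of permuted orders attached to an order. -/
def permMatrix : PermOrderAlg k E →ₐ[k] Matrix (Equiv.Perm E) (Equiv.Perm E) k :=
  RingQuot.liftAlgHom k ⟨relMatrixHom k R, by
    rintro _ _ (⟨Q, hQ⟩ | ⟨S, hS⟩)
    · rw [map_zero]
      refine (relMatrixLin_relBasis k R Q).trans ?_
      ext π σ
      exact if_neg fun h => h.not_inessential hQ
    · refine (relMatrixLin_relBasis k R S).trans (Eq.trans ?_ (relMatrixLin_relBasis k R _).symm)
      ext π σ
      simp only [relMatrix_apply, between_transClosure hS]⟩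

lemma permMatrix_toPermOrderAlg (a : RelAlg k E) :
    permMatrix k R (toPermOrderAlg k E a) = relMatrixLin k R a :=
  RingQuot.liftAlgHom_mkAlgHom_apply k _ _ _

lemma permMatrix_cls (Q : Set (E × E)) : permMatrix k R (cls k Q) = relMatrix k R Q :=
  (permMatrix_toPermOrderAlg k R _).trans (relMatrixLin_relBasis k R Q)

/-- The matrices commute with the right action of `Aut(E,R)`; this is what lets the action pass to
`TFun`. -/
lemma permMatrix_mul_aut (a : PermOrderAlg k E) (π σ : Equiv.Perm E) (τ : R.aut) :
    permMatrix k R a (π * τ) (σ * τ) = permMatrix k R a π σ := by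
  obtain ⟨a, rfl⟩ := toPermOrderAlg_surjective k a
  induction a using relAlg_induction with
  | zero => simp
  | add a b h h' => rw [map_add, map_add, Matrix.add_apply, Matrix.add_apply, h, h']
  | smul c Q =>
    have := permMatrix_cls k R Q
    rw [cls] at this
    rw [map_smul, map_smul, this, Matrix.smul_apply, Matrix.smul_apply, relMatrix_apply,
      relMatrix_apply]
    simp only [Between.mul_aut τ.2]

lemma permMatrix_algOpp (a : RelAlg k E) (π σ : Equiv.Perm E) :
    permMatrix k R.op (toPermOrderAlg k E (algOpp a)) σ π =
      permMatrix k R (toPermOrderAlg k E a) π σ := by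
  rw [permMatrix_toPermOrderAlg, permMatrix_toPermOrderAlg]
  have hadd (a b : RelAlg k E) : algOpp (a + b) = algOpp a + algOpp b := map_add _ _ _
  have hsmul (c : k) (a : RelAlg k E) : algOpp (c • a) = c • algOpp a := map_smul linOpp c a
  induction a using relAlg_induction with
  | zero =>
    rw [show algOpp (0 : RelAlg k E) = 0 from map_zero _, map_zero, map_zero]; rfl
  | add a b h h' => rw [hadd, map_add, map_add, Matrix.add_apply, Matrix.add_apply, h, h']
  | smul c Q =>
    have hQ : algOpp (relBasis k Q) = relBasis k {p | (p.2, p.1) ∈ Q} := linOpp_single _ _ _ _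
    rw [hsmul, hQ, map_smul, map_smul, relMatrixLin_relBasis, relMatrixLin_relBasis,
      Matrix.smul_apply, Matrix.smul_apply, relMatrix_apply, relMatrix_apply]
    simp only [Between.op]

/-- A nonzero entry of an order `S` in column 1 requires `π = 1` and `S ≤ R`. Among the orders above
`R` only `R` itself qualifies, with coefficient `μ(R, R) = 1`. Column 1 can therefore serve as
coordinates on `𝒫_E f_R`. -/
lemma permMatrix_fIdem_apply_one (π : Equiv.Perm E) :
    permMatrix k R (fIdem k R) π 1 = if π = 1 then 1 else 0 := by
  rw [fIdem, map_sum, Matrix.sum_apply, Finset.sum_eq_single R]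
  · rw [map_smul, permMatrix_cls, Matrix.smul_apply, relMatrix_apply]
    have : IncidenceAlgebra.mu k R R = 1 := by simp
    rw [this, one_smul]
    congr 1
    refine propext ⟨fun h => h.eq_of_reflexive R.refl, ?_⟩
    rintro rfl
    exact ⟨fun z => R.refl z, fun a b hab => hab⟩
  · intro S hS hne
    rw [map_smul, permMatrix_cls, Matrix.smul_apply, relMatrix_apply, if_neg, smul_zero]
    intro h
    obtain rfl := h.eq_of_reflexive S.refl
    refine hne (le_antisymm ?_ (Finset.mem_filter.1 hS).2)
    rintro ⟨a, b⟩ hab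
    exact h.2 a b hab
  · intro h; simp at h

/-- The coordinates of an element of the fundamental module in the basis `Δ_σ f_R`. -/
def coord : fundamentalModule k R →ₗ[k] (Equiv.Perm E → k) where
  toFun a π := permMatrix k R (a : PermOrderAlg k E) π 1
  map_add' a b := by
    ext π
    rw [Submodule.coe_add, map_add]; rfl
  map_smul' c a := by
    ext π
    rw [Submodule.coe_smul_of_tower, map_smul]; rfl

lemma coord_apply (a : fundamentalModule k R) (π : Equiv.Perm E) :
    coord k R a π = permMatrix k R (a : PermOrderAlg k E) π 1 := rfl

lemma coord_smul (c : PermOrderAlg k E) (a : fundamentalModule k R) (π : Equiv.Perm E) :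
    coord k R (c • a) π = ∑ σ, permMatrix k R c π σ * coord k R a σ := by
  rw [coord_apply, Submodule.coe_smul, smul_eq_mul, map_mul, Matrix.mul_apply]; rfl

lemma relMatrix_permRel_apply_one (σ π : Equiv.Perm E) :
    relMatrix k R (permRel σ) π 1 = if π = σ then 1 else 0 := by
  rw [relMatrix_apply]
  congr 1
  refine propext ⟨fun h => Equiv.ext h.1, ?_⟩
  rintro rfl
  refine ⟨fun _ => rfl, fun a b hab => ?_⟩
  rw [π.injective hab]; exact R.refl b

lemma coord_permGen (σ π : Equiv.Perm E) :
    coord k R (permGen k R σ) π = if π = σ then 1 else 0 := by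
  rw [coord_apply, permGen, map_mul, Matrix.mul_apply, permMatrix_cls]
  simp only [permMatrix_fIdem_apply_one, mul_ite, mul_one, mul_zero, Finset.sum_ite_eq',
    Finset.mem_univ, if_true, relMatrix_permRel_apply_one]

lemma coord_rightAction (τ : R.aut) (a : fundamentalModule k R) (π : Equiv.Perm E) :
    coord k R (rightAction k R τ a) π = coord k R a (π * (τ : Equiv.Perm E)⁻¹) := by
  have ha : a ∈ Submodule.span k (Set.range (permGen k R)) := span_permGen k R ▸ Submodule.mem_top
  induction ha using Submodule.span_induction with
  | mem _ h =>
    obtain ⟨σ, rfl⟩ := h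
    rw [rightAction_permGen, coord_permGen, coord_permGen]
    simp only [mul_inv_eq_iff_eq_mul]
  | zero => simp
  | add a b _ _ h h' => rw [map_add, map_add, map_add, Pi.add_apply, Pi.add_apply, h, h']
  | smul c a _ h =>
    rw [LinearMap.map_smul_of_tower, map_smul, map_smul, Pi.smul_apply, Pi.smul_apply, h]

end MatrixRepresentation

/-! ### Duality between `T_{R,V}` and `T_{R^op,V^♮}` -/

section AutOp

variable {k : Type u} [CommRing k] {E : Type u} {R : OrderRel E}
variable {V : Type u} [AddCommGroup V] [Module k V] {ρ : Representation k R.aut V}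

lemma autOp_coe (τ : R.op.aut) : (R.autOp τ : Equiv.Perm E) = τ := rfl

lemma autOp_bijective : Function.Bijective R.autOp :=
  ⟨Subgroup.inclusion_injective _, fun τ => ⟨⟨τ, fun x y => τ.2 y x⟩, rfl⟩⟩

lemma dualRep_apply (τ : R.op.aut) (α : Module.Dual k V) (v : V) :
    dualRep R ρ τ α v = α (ρ (R.autOp τ)⁻¹ v) := rfl

end AutOp

section Duality

open scoped Classical

variable {k : Type u} [CommRing k] {E : Type u} [Finite E] {R : OrderRel E}
variable {V : Type u} [AddCommGroup V] [Module k V] {ρ : Representation k R.aut V}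
variable {M : Type u} [AddCommGroup M] [Module k M]

/-- The map out of `T_{R,V}` given by a balanced map out of `𝒫_E f_R ⊗ V`. -/
def TLift (g : fundamentalModule k R ⊗[k] V →ₗ[k] M)
    (hg : ∀ a (τ : R.aut) v, g (rightAction k R τ a ⊗ₜ[k] v) = g (a ⊗ₜ[k] ρ τ v)) :
    TModule R ρ →ₗ[k] M :=
  Submodule.liftQ ((TRel R ρ).restrictScalars k) g (by
      intro t ht
      rw [Submodule.restrictScalars_mem] at ht
      -- `TRel` is a `𝒫_E`-span while `g` is only `k`-linear, so the induction needs the statement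
      -- for all multiples of `t`.
      have key : ∀ c : PermOrderAlg k E, g (c • t) = 0 := by
        induction ht using Submodule.span_induction with
        | mem t h =>
          obtain ⟨a, τ, v, rfl⟩ := h
          intro c
          rw [smul_sub, TensorProduct.smul_tmul', TensorProduct.smul_tmul', ← map_smul, map_sub, hg,
            sub_self]
        | zero => simp
        | add x y _ _ hx hy => intro c; rw [smul_add, map_add, hx, hy, add_zero]
        | smul b x _ hx => intro c; rw [← mul_smul, hx]
      simpa using key 1) ∘ₗ
    (Submodule.Quotient.restrictScalarsEquiv k (TRel R ρ)).symm.toLinearMap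

/-- The class of `a ⊗ v` in `T_{R,V}`. -/
def tmk (ρ : Representation k R.aut V) (a : fundamentalModule k R) (v : V) : TModule R ρ :=
  Submodule.Quotient.mk (a ⊗ₜ[k] v)

lemma tmk_add_left (a b : fundamentalModule k R) (v : V) :
    tmk ρ (a + b) v = tmk ρ a v + tmk ρ b v := by
  unfold tmk; rw [TensorProduct.add_tmul]; rfl

lemma tmk_smul_left (c : k) (a : fundamentalModule k R) (v : V) :
    tmk ρ (c • a) v = tmk ρ a (c • v) := by
  unfold tmk; rw [TensorProduct.smul_tmul]

lemma tmk_add (a : fundamentalModule k R) (v w : V) :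
    tmk ρ a (v + w) = tmk ρ a v + tmk ρ a w := by
  unfold tmk; rw [TensorProduct.tmul_add]; rfl

lemma tmk_zero (a : fundamentalModule k R) : tmk ρ a 0 = 0 := by
  unfold tmk; rw [TensorProduct.tmul_zero]; rfl

lemma smul_tmk (c : PermOrderAlg k E) (a : fundamentalModule k R) (v : V) :
    c • tmk ρ a v = tmk ρ (c • a) v := rfl

lemma tmk_rightAction (a : fundamentalModule k R) (τ : R.aut) (v : V) :
    tmk ρ (rightAction k R τ a) v = tmk ρ a (ρ τ v) :=
  (Submodule.Quotient.eq _).2 (Submodule.subset_span ⟨a, τ, v, rfl⟩)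

lemma TModule_induction {P : TModule R ρ → Prop} (x : TModule R ρ) (zero : P 0)
    (add : ∀ x y, P x → P y → P (x + y)) (tmk : ∀ a v, P (tmk ρ a v)) : P x := by
  obtain ⟨x, rfl⟩ := Submodule.Quotient.mk_surjective _ x
  induction x using TensorProduct.induction_on with
  | zero => exact zero
  | tmul a v => exact tmk a v
  | add x y hx hy => exact add _ _ hx hy

lemma TModule_induction_permGen {P : TModule R ρ → Prop} (x : TModule R ρ) (zero : P 0)
    (add : ∀ x y, P x → P y → P (x + y)) (permGen : ∀ σ v, P (tmk ρ (permGen k R σ) v)) :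
    P x := by
  refine TModule_induction x zero add fun a => ?_
  have ha := span_permGen k R ▸ Submodule.mem_top (x := a)
  induction ha using Submodule.span_induction with
  | mem _ h => obtain ⟨σ, rfl⟩ := h; exact permGen σ
  | zero =>
    intro v
    rwa [show tmk ρ 0 v = 0 by unfold tmk; rw [TensorProduct.zero_tmul]; rfl]
  | add a b _ _ h h' => intro v; rw [tmk_add_left]; exact add _ _ (h v) (h' v)
  | smul c a _ h => intro v; rw [tmk_smul_left]; exact h _

instance [Module.Finite k V] : Module.Finite k (TModule R ρ) :=
  Module.Finite.equiv (Submodule.Quotient.restrictScalarsEquiv k (TRel R ρ))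

/-- The map from `T_{R,V}` to the functions on permutations with values in `V`, identifying
`T_{R,V}` with the functions `h` such that `h (π τ) = τ⁻¹ h(π)` for `τ ∈ Aut(E,R)`. -/
def TFun (ρ : Representation k R.aut V) : TModule R ρ →ₗ[k] (Equiv.Perm E → V) :=
  TLift (TensorProduct.lift (LinearMap.mk₂ k
      (fun (a : fundamentalModule k R) (v : V) (π : Equiv.Perm E) =>
        ∑ τ : R.aut, coord k R a (π * (τ : Equiv.Perm E)) • ρ τ v)
      (fun a b v => by ext π; simp [add_smul, Finset.sum_add_distrib])
      (fun c a v => by ext π; simp [mul_smul, Finset.smul_sum])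
      (fun a v w => by ext π; simp [Finset.sum_add_distrib])
      (fun c a v => by ext π; simp [Finset.smul_sum, smul_comm c])))
    (fun a τ v => by
      ext π
      rw [TensorProduct.lift.tmul, TensorProduct.lift.tmul]
      change ∑ θ : R.aut, coord k R (rightAction k R τ a) (π * (θ : Equiv.Perm E)) • ρ θ v =
        ∑ θ : R.aut, coord k R a (π * (θ : Equiv.Perm E)) • ρ θ (ρ τ v)
      refine Fintype.sum_equiv (Equiv.mulRight τ⁻¹) _ _ fun θ => ?_
      rw [coord_rightAction, ← Module.End.mul_apply, ← map_mul]
      simp [mul_assoc])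

lemma TFun_tmk (a : fundamentalModule k R) (v : V) (π : Equiv.Perm E) :
    TFun ρ (tmk ρ a v) π = ∑ τ : R.aut, coord k R a (π * (τ : Equiv.Perm E)) • ρ τ v := rfl

lemma TFun_mul_aut (x : TModule R ρ) (π : Equiv.Perm E) (τ : R.aut) :
    TFun ρ x (π * (τ : Equiv.Perm E)) = ρ τ⁻¹ (TFun ρ x π) := by
  induction x using TModule_induction with
  | zero => simp
  | add x y hx hy =>
    rw [map_add, Pi.add_apply, Pi.add_apply, map_add, hx, hy]
  | tmk a v =>
    rw [TFun_tmk, TFun_tmk, map_sum]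
    refine Fintype.sum_equiv (Equiv.mulLeft τ) _ _ fun θ => ?_
    rw [map_smul, ← Module.End.mul_apply, ← map_mul]
    simp [mul_assoc]

lemma TFun_smul (c : PermOrderAlg k E) (x : TModule R ρ) (π : Equiv.Perm E) :
    TFun ρ (c • x) π = ∑ σ, permMatrix k R c π σ • TFun ρ x σ := by
  induction x using TModule_induction with
  | zero => simp
  | add x y hx hy =>
    simp only [smul_add, map_add, Pi.add_apply, hx, hy, Finset.sum_add_distrib]
  | tmk a v =>
    simp only [smul_tmk, TFun_tmk, coord_smul, Finset.sum_smul, Finset.smul_sum, mul_smul]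
    rw [Finset.sum_comm]
    conv_rhs => rw [Finset.sum_comm]
    rw [Finset.sum_comm]
    refine Finset.sum_congr rfl fun τ _ => ?_
    refine Fintype.sum_equiv (Equiv.mulRight (τ : Equiv.Perm E)⁻¹) _ _ fun σ => ?_
    rw [← permMatrix_mul_aut k R c π _ τ]
    simp

lemma TFun_permGen (σ π : Equiv.Perm E) (v : V) :
    TFun ρ (tmk ρ (permGen k R σ) v) π =
      ∑ τ : R.aut, (if π * (τ : Equiv.Perm E) = σ then (1 : k) else 0) • ρ τ v := by
  simp only [TFun_tmk, coord_permGen]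

lemma TFun_permGen_self (σ : Equiv.Perm E) (v : V) :
    TFun ρ (tmk ρ (permGen k R σ) v) σ = v := by
  rw [TFun_permGen, Finset.sum_eq_single 1]
  · simp
  · intro τ _ hτ
    rw [if_neg (by simpa using hτ), zero_smul]
  · intro h; exact absurd (Finset.mem_univ _) h

lemma TFun_permGen_of_ne (σ π : Equiv.Perm E) (v : V)
    (h : (π : Equiv.Perm E ⧸ R.aut) ≠ (σ : Equiv.Perm E ⧸ R.aut)) :
    TFun ρ (tmk ρ (permGen k R σ) v) π = 0 := by
  rw [TFun_permGen]
  refine Finset.sum_eq_zero fun τ _ => ?_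
  rw [if_neg, zero_smul]
  rintro rfl
  exact h (QuotientGroup.mk_mul_of_mem π τ.2).symm

/-- An element of `T_{R,V}` is determined by the associated function on coset representatives. -/
lemma sum_TFun (x : TModule R ρ) :
    ∑ i : Equiv.Perm E ⧸ R.aut, tmk ρ (permGen k R i.out) (TFun ρ x i.out) = x := by
  induction x using TModule_induction_permGen with
  | zero => simp [tmk_zero]
  | add x y hx hy =>
    simp only [map_add, Pi.add_apply, tmk_add, Finset.sum_add_distrib, hx, hy]
  | permGen σ v =>
    rw [Finset.sum_eq_single (σ : Equiv.Perm E ⧸ R.aut)]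
    -- The chosen representative is `σ τ`; moving `τ` across the tensor sign cancels the `τ⁻¹`
    -- produced by equivariance.
    · obtain ⟨τ, hτ⟩ := QuotientGroup.mk_out_eq_mul R.aut σ
      rw [hτ, TFun_mul_aut, TFun_permGen_self, ← rightAction_permGen, tmk_rightAction,
        ← Module.End.mul_apply, ← map_mul]
      simp
    · intro i _ hi
      rw [TFun_permGen_of_ne _ _ _ (by rwa [QuotientGroup.out_eq']), tmk_zero]
    · intro h; exact absurd (Finset.mem_univ _) h

lemma eq_zero_of_TFun {x : TModule R ρ} (h : ∀ π, TFun ρ x π = 0) : x = 0 := by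
  rw [← sum_TFun x]
  exact Finset.sum_eq_zero fun i _ => by rw [h, tmk_zero]

/-- For `b ∈ 𝒫_E f_R` and `α ∈ V^♮`, the linear form `h ↦ ∑ b_π α(h(π))` on the functions
on permutations with values in `V`. -/
def funForm (k : Type u) [CommRing k] (R : OrderRel E) (V : Type u) [AddCommGroup V] [Module k V] :
    fundamentalModule k R →ₗ[k] Module.Dual k V →ₗ[k] Module.Dual k (Equiv.Perm E → V) :=
  LinearMap.mk₂ k (fun b α => ∑ π, coord k R b π • (α ∘ₗ LinearMap.proj π))
    (fun a b α => by simp [add_smul, Finset.sum_add_distrib])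
    (fun c a α => by simp [mul_smul, Finset.smul_sum])
    (fun a α β => by simp [LinearMap.add_comp, Finset.sum_add_distrib])
    (fun c a α => by simp [LinearMap.smul_comp, Finset.smul_sum, smul_comm c])

/-- For `b ∈ 𝒫_E f_{R^op}` and `α ∈ V^♮`, the linear form on `T_{R,V}` given by `b ⊗ α`. -/
def TForm (ρ : Representation k R.aut V) :
    fundamentalModule k R.op →ₗ[k] Module.Dual k V →ₗ[k] Module.Dual k (TModule R ρ) :=
  (funForm k R.op V).compr₂ (TFun ρ).dualMap

lemma TForm_apply (b : fundamentalModule k R.op) (α : Module.Dual k V) (x : TModule R ρ) :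
    TForm ρ b α x = ∑ π, coord k R.op b π * α (TFun ρ x π) := by
  change funForm k R.op V b α (TFun ρ x) = _
  simp [funForm]

lemma TForm_rightAction (b : fundamentalModule k R.op) (τ : R.op.aut) (α : Module.Dual k V) :
    TForm ρ (rightAction k R.op τ b) α = TForm ρ b (dualRep R ρ τ α) := by
  apply LinearMap.ext; intro x
  rw [TForm_apply, TForm_apply]
  refine Fintype.sum_equiv (Equiv.mulRight (τ : Equiv.Perm E)⁻¹) _ _ fun π => ?_
  rw [coord_rightAction, dualRep_apply, ← TFun_mul_aut]
  simp [autOp_coe]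

/-- The pairing of `T_{R,V}` and `T_{R^op,V^♮}`. -/
def TPairing (ρ : Representation k R.aut V) :
    TModule R ρ →ₗ[k] TModule R.op (dualRep R ρ) →ₗ[k] k :=
  LinearMap.flip (TLift (TensorProduct.lift (TForm ρ)) (fun b τ α => by
    rw [TensorProduct.lift.tmul, TensorProduct.lift.tmul, TForm_rightAction]))

lemma TPairing_tmk (x : TModule R ρ) (b : fundamentalModule k R.op) (α : Module.Dual k V) :
    TPairing ρ x (tmk (dualRep R ρ) b α) = ∑ π, coord k R.op b π * α (TFun ρ x π) :=
  TForm_apply b α x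

lemma TPairing_permGen (x : TModule R ρ) (σ : Equiv.Perm E) (α : Module.Dual k V) :
    TPairing ρ x (tmk (dualRep R ρ) (permGen k R.op σ) α) = α (TFun ρ x σ) := by
  rw [TPairing_tmk]
  simp [coord_permGen]

/-- The asymmetrically defined pairing is also evaluation of the function attached to `y`, so
separation on the right follows from injectivity of `TFun` for `R^op`. -/
lemma TPairing_permGen_left (y : TModule R.op (dualRep R ρ)) (σ : Equiv.Perm E) (v : V) :
    TPairing ρ (tmk ρ (permGen k R σ) v) y = TFun (dualRep R ρ) y σ v := by
  induction y using TModule_induction with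
  | zero => simp
  | add x y hx hy =>
    rw [map_add, map_add, hx, hy]; rfl
  | tmk b α =>
    rw [TPairing_tmk, TFun_tmk]
    simp only [TFun_permGen, map_sum, map_smul, Finset.mul_sum, LinearMap.sum_apply,
      LinearMap.smul_apply, dualRep_apply, smul_eq_mul]
    rw [Finset.sum_comm]
    symm
    refine Fintype.sum_bijective (fun τ => (R.autOp τ)⁻¹)
      ((Equiv.inv _).bijective.comp autOp_bijective) _ _ fun τ => ?_
    rw [Finset.sum_eq_single (σ * (τ : Equiv.Perm E))]
    · simp [autOp_coe]
    · intro π _ hπ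
      rw [if_neg, zero_mul, mul_zero]
      rintro rfl
      exact hπ (by simp [autOp_coe])
    · intro h; exact absurd (Finset.mem_univ _) h

lemma TPairing_oppInvariant : OppInvariant (E := E) (TPairing ρ) := by
  intro a x y
  change TPairing ρ (toPermOrderAlg k E a • x) y = TPairing ρ x (toPermOrderAlg k E (algOpp a) • y)
  induction y using TModule_induction with
  | zero => simp
  | add y z hy hz =>
    rw [map_add, smul_add, map_add, hy, hz]
  | tmk b α =>
    rw [smul_tmk, TPairing_tmk, TPairing_tmk]
    simp only [TFun_smul, coord_smul, map_sum, map_smul, smul_eq_mul, Finset.mul_sum,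
      Finset.sum_mul, permMatrix_algOpp]
    rw [Finset.sum_comm]
    refine Finset.sum_congr rfl fun σ _ => Finset.sum_congr rfl fun π _ => ?_
    ring

lemma TPairing_separatingRight : (TPairing ρ).SeparatingRight := by
  intro y h
  refine eq_zero_of_TFun fun σ => LinearMap.ext fun v => ?_
  rw [← TPairing_permGen_left, h]; rfl

end Duality

/-! ### Separation on the left, and finite-dimensionality. -/

section Irreducible

variable {k : Type u} [Field k] {E : Type u} [Finite E] {R : OrderRel E}
variable {V : Type u} [AddCommGroup V] [Module k V] {ρ : Representation k R.aut V}

lemma TPairing_separatingLeft : (TPairing ρ).SeparatingLeft := by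
  intro x h
  -- Pairing with `Δ_σ f_{R^op} ⊗ α` returns `α(h(σ))`, and over a field linear forms separate the
  -- points of `V`.
  refine eq_zero_of_TFun fun σ => ?_
  rw [← Module.forall_dual_apply_eq_zero_iff k]
  intro α
  rw [← TPairing_permGen, h]

end Irreducible

/-- An irreducible representation of a finite group is finite-dimensional. -/
lemma finite_of_isIrreducible {k G V : Type*} [Field k] [Group G] [Finite G] [AddCommGroup V]
    [Module k V] {ρ : Representation k G V} (hρ : ρ.IsIrreducible) : Module.Finite k V := by
  have := (Representation.irreducible_iff_isSimpleModule_asModule ρ).1 hρ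
  -- A simple module is cyclic over the group algebra, which is finite-dimensional.
  have : Module.Finite k ρ.asModule := Module.Finite.trans (MonoidAlgebra k G) _
  exact this

end CorrespondenceFunctors

end

theorem mainTheorem8 (k : Type u) [Field k] (E : Type u) [Finite E]
    (R : CorrespondenceFunctors.OrderRel E)
    (V : Type u) [AddCommGroup V] [Module k V] (ρ : Representation k R.aut V)
    (hρ : ρ.IsIrreducible) :
    Nonempty (CorrespondenceFunctors.dualFunctor (CorrespondenceFunctors.simpleFunctor R ρ) ≅
      CorrespondenceFunctors.simpleFunctor R.op (CorrespondenceFunctors.dualRep R ρ)) := by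
  have := CorrespondenceFunctors.finite_of_isIrreducible hρ
  exact ⟨CorrespondenceFunctors.dualQuotientFunctorIso (CorrespondenceFunctors.TPairing ρ)
    CorrespondenceFunctors.TPairing_oppInvariant CorrespondenceFunctors.TPairing_separatingLeft
    CorrespondenceFunctors.TPairing_separatingRight⟩
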